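/- **Proposition 2.4 (quasi-periodic averaging step).** *Setting.* Let $n\ge 2$, $0<s\le 1$, $\tau\ge 0$ and $\gamma>0$. All norms $|\cdot|$ on $\mathbb{Z}^{j},\mathbb{R}^{j},\mathbb{C}^j$ are maximum norms, $\mathbb{T}^n=\mathbb{R}^n/\mathbb{Z}^n$, $\mathbb{T}^n_s=\{\theta\in\mathbb{C}^n/\mathbb{Z}^n : |\operatorname{Im}\theta|<s\}$, and $|F|_s=\sup_{\mathbb{T}^n_s}|F|$. "Real-analytic" means holomorphic on the complex domain and real for real arguments. Let $\alpha=(1,\tilde\alpha)$, where $\tilde\alpha\in[-1,1]^{n-1}$ satisfies $$\operatorname{dist}(k\cdot\tilde\alpha,\mathbb{Z})\ \ge\ \gamma\,|k|^{-(1+\tau)(n-1)}\qquad (k\in\mathbb{Z}^{n-1}\setminus\{0\}).$$ There then exists $\bar\gamma>0$ such that $$\operatorname{dist}(q\tilde\alpha,\mathbb{Z}^{n-1})\ \ge\ \bar\gamma\, q^{-(1+(n-1)\tau)/(n-1)}\qquad (q\in\mathbb{N},\ q\ge 1),\tag{K}$$ and $\bar\gamma$ denotes any constant satisfying (K). Put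 $$a=1+(n-1)\tau,\quad b=4^{na},\quad d=(1-b^{-1})^{-1},\quad \gamma^*=\Bigl(n^{-1}\gamma\,\bar\gamma^{\frac{n-1}{1+(n-1)\tau}}\Bigr)^{\frac1{n+(n-1)\tau}}.$$ *Statement.* There is a constant $C\ge 1$ depending only on $n,s,\tau,\gamma,\bar\gamma$ with the following property. Let $\varepsilon\ge 0$, let $X=X_\alpha+P$, where $X_\alpha=\alpha$ is the constant vector field and $P$ is a real-analytic vector field on $\mathbb{T}^n_s$ with $|P|_s\le\varepsilon$, and let $Y=X+S$, where $S$ is an analytic (not necessarily real) vector field on $\mathbb{T}^n_s$ with $|S|_s\le d\varepsilon$. Let $0<\sigma<s$ and $Q\ge 1$ satisfy $$Q^n\varepsilon\le 1,\qquad C\,Q^{-1}\sigma^{-1}\le 1,\qquad Q\,\sigma^{1-n}\,e^{-\gamma^* Q^{1/a}\sigma/2}\le 1 .$$ Then there exist an integer $q$ with $1\le q\le Q^{n-1}$, a vector $p\in\mathbb{Z}^{n-1}$ with $|\tilde\alpha-q^{-1}p|\le (qQ)^{-1}$, a real-analytic embedding $\Phi_1:\mathbb{T}^n_{s-\sigma}\to\mathbb{T}^n_s$,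 and an analytic vector field $P^+$ on $\mathbb{T}^n_{s-\sigma}$ (real for real arguments if $S$ is) such that, with $\omega=(1,q^{-1}p)$, $X^t_{q\omega}(z)=z+tq\omega$ and $[P]_\omega=\int_0^1P\circ X^t_{q\omega}\,dt$, the map $\Phi_1$ is the time-one map of $$V=q\int_0^1 t\,(P-[P]_\omega)\circ X^t_{q\omega}\,dt,$$ and $$\Phi_1^*Y=X_\alpha+S+[P]+P^+\ \text{ on }\mathbb{T}^n_{s-\sigma},\qquad [P]=\int_{\mathbb{T}^n}P,$$ $$|\Phi_1-\mathrm{Id}|_{s-\sigma}\le Q^{n-1}\varepsilon,\qquad |P^+|_{s-\sigma}\le b^{-1}\varepsilon .$$ Here $(\Phi_1^*Y)(z)=D\Phi_1(z)^{-1}\,Y(\Phi_1(z))$. -/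

import Mathlib

namespace KAM

/-! ### Diophantine conditions (with `m = n - 1`; all norms on `Fin m → ℤ`, `Fin m → ℝ` and
`Fin n → ℂ` are maximum norms) -/

/-- The distance from a real number to the lattice `ℤ`. -/
noncomputable def distInt (y : ℝ) : ℝ := ⨅ l : ℤ, |y - l|

/-- The distance, in the maximum norm, from a point of `ℝ^m` to the lattice `ℤ^m`. -/
noncomputable def distLattice {m : ℕ} (y : Fin m → ℝ) : ℝ :=
  ⨅ l : Fin m → ℤ, ‖fun j => y j - (l j : ℝ)‖

/-- `x ∈ [-1,1]^m` satisfies `‖k · x‖_ℤ ≥ γ |k|^{-(1+τ)m}` for all `k ∈ ℤ^m \ {0}`. -/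
def LinearDiophantine {m : ℕ} (τ γ : ℝ) (x : Fin m → ℝ) : Prop :=
  (∀ j, x j ∈ Set.Icc (-1 : ℝ) 1) ∧
    ∀ k : Fin m → ℤ, k ≠ 0 →
      γ * ‖k‖ ^ (-((1 + τ) * (m : ℝ))) ≤ distInt (∑ j, (k j : ℝ) * x j)

/-- `x ∈ ℝ^m` satisfies `‖q x‖_{ℤ^m} ≥ γ' q^{-(1+mτ)/m}` for all integers `q ≥ 1`. -/
def SimultaneousDiophantine {m : ℕ} (τ γ' : ℝ) (x : Fin m → ℝ) : Prop :=
  ∀ q : ℕ, 1 ≤ q →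
    γ' * (q : ℝ) ^ (-((1 + (m : ℝ) * τ) / (m : ℝ))) ≤ distLattice (fun j => (q : ℝ) * x j)

/-! ### The constants -/

/-- `a = 1 + (n-1)τ`. -/
noncomputable def aConst (n : ℕ) (τ : ℝ) : ℝ := 1 + ((n : ℝ) - 1) * τ

/-- `b = 4^{na}`. -/
noncomputable def bConst (n : ℕ) (τ : ℝ) : ℝ := (4 : ℝ) ^ ((n : ℝ) * aConst n τ)

/-- `d = (1 - b⁻¹)⁻¹`. -/
noncomputable def dConst (n : ℕ) (τ : ℝ) : ℝ := (1 - (bConst n τ)⁻¹)⁻¹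

/-- `γ* = (n⁻¹ γ γ'^{(n-1)/(1+(n-1)τ)})^{1/(n+(n-1)τ)}`. -/
noncomputable def gammaStar (n : ℕ) (τ γ γ' : ℝ) : ℝ :=
  ((n : ℝ)⁻¹ * γ * γ' ^ (((n : ℝ) - 1) / (1 + ((n : ℝ) - 1) * τ))) ^
    (1 / ((n : ℝ) + ((n : ℝ) - 1) * τ))

/-! ### Complex neighbourhoods of the torus, vector fields and embeddings

Objects on the complex neighbourhood `𝕋ⁿ_s` of `𝕋ⁿ = ℝⁿ/ℤⁿ` are given by their lifts to the
strip `|Im z| < s` in `ℂⁿ`: vector fields are `ℤⁿ`-periodic maps, and maps between such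
neighbourhoods that are close to the identity are maps commuting with integer translations. -/

/-- The lift to `ℂⁿ` of `𝕋ⁿ_s`. -/
def strip (n : ℕ) (s : ℝ) : Set (Fin n → ℂ) := {z | ∀ j, |(z j).im| < s}

/-- The integer vector `k`, as a vector in `ℂⁿ`. -/
def intVec {n : ℕ} (k : Fin n → ℤ) : Fin n → ℂ := fun j => (k j : ℂ)

/-- The real vector `x`, as a vector in `ℂⁿ`. -/
def realVec {n : ℕ} (x : Fin n → ℝ) : Fin n → ℂ := fun j => (x j : ℂ)

/-- The map takes real vectors to real vectors. -/
def RealOnReals {n : ℕ} (F : (Fin n → ℂ) → (Fin n → ℂ)) : Prop :=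
  ∀ x : Fin n → ℝ, ∀ j, (F (realVec x) j).im = 0

/-- Analytic (that is, holomorphic) vector fields on `𝕋ⁿ_s`. -/
structure IsAnalyticField {n : ℕ} (s : ℝ) (F : (Fin n → ℂ) → (Fin n → ℂ)) : Prop where
  holomorphic : DifferentiableOn ℂ F (strip n s)
  periodic : ∀ z ∈ strip n s, ∀ k : Fin n → ℤ, F (z + intVec k) = F z

/-- `|F|_s ≤ M`, where `|F|_s` is the supremum of `|F|` over `𝕋ⁿ_s`. -/
def NormLE {n : ℕ} (s : ℝ) (F : (Fin n → ℂ) → (Fin n → ℂ)) (M : ℝ) : Prop :=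
  ∀ z ∈ strip n s, ‖F z‖ ≤ M

/-- Real-analytic embeddings `𝕋ⁿ_r → 𝕋ⁿ_s`, given by a lift `F`. The induced map is injective, is
an immersion, and is a homeomorphism onto its image (it is open). -/
structure IsRealAnalyticEmbedding {n : ℕ} (r s : ℝ) (F : (Fin n → ℂ) → (Fin n → ℂ)) :
    Prop where
  holomorphic : DifferentiableOn ℂ F (strip n r)
  real : RealOnReals F
  equivariant : ∀ z ∈ strip n r, ∀ k : Fin n → ℤ, F (z + intVec k) = F z + intVec k
  mapsTo : Set.MapsTo F (strip n r) (strip n s)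
  injective_mod : ∀ z ∈ strip n r, ∀ w ∈ strip n r, ∀ k : Fin n → ℤ,
    F z = F w + intVec k → z = w + intVec k
  immersion : ∀ z ∈ strip n r, Function.Bijective (fderiv ℂ F z)
  open_image : ∀ U : Set (Fin n → ℂ), U ⊆ strip n r → IsOpen U → IsOpen (F '' U)

/-- `F` is the time-one map, on the strip of width `r`, of the vector field `V` defined on the strip
of width `s`: the integral curve of `V` that starts at `z` exists in the latter strip on `[0,1]`
and ends at `F z`. -/
def IsTimeOneMap {n : ℕ} (r s : ℝ) (V F : (Fin n → ℂ) → (Fin n → ℂ)) : Prop :=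
  ∀ z ∈ strip n r, ∃ c : ℝ → (Fin n → ℂ), c 0 = z ∧ c 1 = F z ∧
    ∀ t ∈ Set.Icc (0 : ℝ) 1,
      c t ∈ strip n s ∧ HasDerivWithinAt c (V (c t)) (Set.Icc (0 : ℝ) 1) t

/-! ### Averages and the vector field `V` -/

/-- The space average `[P] = ∫_{𝕋ⁿ} P`. -/
noncomputable def spaceAverage {n : ℕ} (P : (Fin n → ℂ) → (Fin n → ℂ)) : Fin n → ℂ :=
  ∫ x in Set.Icc (0 : Fin n → ℝ) 1, P (realVec x)

/-- The vector `(1, x) ∈ ℝ × ℝ^m`. -/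
def frequency {m : ℕ} (x : Fin m → ℝ) : Fin (m + 1) → ℝ := Fin.cons 1 x

/-- The time-`t` map `z ↦ z + t v` of the constant vector field `v`. -/
def constFlow {n : ℕ} (v : Fin n → ℝ) (t : ℝ) (z : Fin n → ℂ) : Fin n → ℂ :=
  z + realVec (t • v)

/-- `[P]_ω = ∫_0^1 P ∘ X_{qω}^t dt`. -/
noncomputable def periodicAverage {n : ℕ} (q : ℕ) (ω : Fin n → ℝ)
    (P : (Fin n → ℂ) → (Fin n → ℂ)) (z : Fin n → ℂ) : Fin n → ℂ :=
  ∫ t in (0 : ℝ)..1, P (constFlow ((q : ℝ) • ω) t z)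

/-- `V = q ∫_0^1 t (P - [P]_ω) ∘ X_{qω}^t dt`. -/
noncomputable def averagingField {n : ℕ} (q : ℕ) (ω : Fin n → ℝ)
    (P : (Fin n → ℂ) → (Fin n → ℂ)) (z : Fin n → ℂ) : Fin n → ℂ :=
  (q : ℝ) • ∫ t in (0 : ℝ)..1, t • (P (constFlow ((q : ℝ) • ω) t z) -
    periodicAverage q ω P (constFlow ((q : ℝ) • ω) t z))

end KAM

/-!
The frequency `α = (1, x)` is replaced by a rational vector `ω = (1, p / q)`, with
`1 ≤ q ≤ Q ^ m` and `|α - ω| ≤ (q Q)⁻¹`, given by Dirichlet's theorem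
(`exists_simultaneous_approx`). The flow of `q ω` is `1`-periodic on the torus, so that the
homological equation can be solved without small divisors: `V` is a weighted average of `P` along
this flow, with the weight `q (t - 1/2)` of mean zero (`averagingField_eq`), and integration by
parts gives `DV · ω = P - [P]_ω` (`fderiv_weightedAverage_apply`). Hence the time-one map `Φ` of `V`
removes `P - [P]_ω` up to terms of second order, which are `O(ε / (Q σ))` because
`|V| ≤ q ε ≤ Q⁻¹`.

The point that needs care is that `V` itself is larger than `ε` by a factor `q`, so the derivative
of `Φ` in the direction `ω` cannot be estimated through the size of `V` alone. Instead `DΦ` is the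
solution at time one of the variational equation `W' = DV(c) W` along the orbits
(`hasFDerivAt_timeOne`), and `W ω - ω` satisfies a linear equation whose inhomogeneity
`DV · ω = P - [P]_ω` is of size `ε` (`norm_linear_flow_apply_sub_le`). The remainder is defined by
the conjugacy equation, and `exists_averaging_conjugacy` bounds it by a multiple of `ε / (Q σ)`.

The average `[P]_ω` differs from the mean value `[P]` by the Fourier modes `k ≠ 0` with `k · ω = 0`.
By the two Diophantine conditions such `k` have size at least `γ* Q ^ (1 / a)`
(`gammaStar_mul_le_norm`), and Fourier coefficients on a complex torus decay exponentially
(`norm_torusCoeff_le`), because the torus average of a holomorphic function does not depend on the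
imaginary part of the torus (`torusAverage_eq`). So the difference is exponentially small
(`norm_weightedAverage_sub_spaceAverage_le`).

That a simultaneous Diophantine constant exists is Khintchine's transference principle
(`LinearDiophantine.simultaneousDiophantine`).
-/

open Set Metric Filter MeasureTheory
open scoped Topology

namespace KAM

/-! ### Holomorphic maps of several complex variables -/

section Holomorphic

variable {n : ℕ} {F : Type*} [NormedAddCommGroup F] [NormedSpace ℂ F]

/-- Cauchy's estimate for the first derivative, applied on complex lines through `z`. -/
theorem norm_fderiv_le_of_ball {E : Type*} [NormedAddCommGroup E] [NormedSpace ℂ E]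
    {f : E → F} {z : E} {ρ M : ℝ} (hρ : 0 < ρ)
    (hf : DifferentiableOn ℂ f (ball z ρ)) (hM : ∀ w ∈ ball z ρ, ‖f w‖ ≤ M) :
    ‖fderiv ℂ f z‖ ≤ M / ρ := by
  have hM0 : 0 ≤ M := (norm_nonneg _).trans (hM z (mem_ball_self hρ))
  refine ContinuousLinearMap.opNorm_le_bound _ (by positivity) fun v => ?_
  rcases eq_or_ne v 0 with rfl | hv
  · simp
  have hv' : 0 < ‖v‖ := norm_pos_iff.2 hv
  have key : ∀ R ∈ Ioo 0 ρ, ‖fderiv ℂ f z v‖ ≤ M / R * ‖v‖ := by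
    rintro R ⟨hR0, hR⟩
    have hline : ∀ ζ : ℂ, ζ ∈ closedBall (0 : ℂ) (R / ‖v‖) → z + ζ • v ∈ ball z ρ := by
      intro ζ hζ
      rw [mem_closedBall_zero_iff, le_div_iff₀ hv'] at hζ
      simpa [norm_smul] using hζ.trans_lt hR
    have hderiv : ∀ ζ : ℂ, ζ ∈ closedBall (0 : ℂ) (R / ‖v‖) →
        HasDerivAt (fun ζ : ℂ => f (z + ζ • v)) (fderiv ℂ f (z + ζ • v) v) ζ := by
      intro ζ hζ
      have h1 := ((hf _ (hline ζ hζ)).differentiableAt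
        (isOpen_ball.mem_nhds (hline ζ hζ))).hasFDerivAt
      have h2 : HasDerivAt (fun ζ : ℂ => z + ζ • v) v ζ := by
        simpa using ((hasDerivAt_id ζ).smul_const v).const_add z
      exact h1.comp_hasDerivAt ζ h2
    have hd : DiffContOnCl ℂ (fun ζ : ℂ => f (z + ζ • v)) (ball 0 (R / ‖v‖)) := by
      refine DifferentiableOn.diffContOnCl fun ζ hζ =>
        (hderiv ζ (closure_ball_subset_closedBall hζ)).differentiableAt.differentiableWithinAt
    have h0 := hderiv 0 (mem_closedBall_self (by positivity))
    have := Complex.norm_deriv_le_of_forall_mem_sphere_norm_le (c := (0 : ℂ)) (C := M)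
      (by positivity : 0 < R / ‖v‖) hd
      (fun ζ hζ => hM _ (hline ζ (sphere_subset_closedBall hζ)))
    rw [h0.deriv] at this
    simp only [zero_smul, add_zero] at this
    calc _ ≤ _ := this
      _ = _ := by field_simp
  have hlim : Tendsto (fun R : ℝ => M / R * ‖v‖) (𝓝[<] ρ) (𝓝 (M / ρ * ‖v‖)) := by
    apply Tendsto.mono_left _ nhdsWithin_le_nhds
    exact ((continuousAt_const.div continuousAt_id hρ.ne').mul continuousAt_const)
  exact ge_of_tendsto hlim (by filter_upwards [Ioo_mem_nhdsLT hρ] with R hR using key R hR)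

theorem clm_eq_sum_smulRight (A : (Fin n → ℂ) →L[ℂ] F) :
    A = ∑ i, (ContinuousLinearMap.proj (R := ℂ) (φ := fun _ : Fin n => ℂ) i).smulRight
      (A (Pi.single i 1)) := by
  ext v
  conv_lhs => rw [← Finset.univ_sum_single v]
  rw [map_sum]
  simp only [_root_.sum_apply, ContinuousLinearMap.smulRight_apply,
    ContinuousLinearMap.proj_apply]
  refine Finset.sum_congr rfl fun i _ => ?_
  rw [← map_smul, ← Pi.single_smul]
  simp

/-- Differentiation under the integral sign for holomorphic integrands. By Cauchy's estimate a
uniform bound of the integrand suffices, and the derivative is measurable in the parameter as a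
limit of difference quotients. -/
theorem hasFDerivAt_integral_of_ball {α : Type*} [MeasurableSpace α] {μ : Measure α}
    [IsFiniteMeasure μ] [NormedSpace ℝ F] [CompleteSpace F] {f : (Fin n → ℂ) → α → F}
    {z : Fin n → ℂ} {ρ M : ℝ}
    (hρ : 0 < ρ) (hmeas : ∀ w ∈ ball z ρ, AEStronglyMeasurable (f w) μ)
    (hdiff : ∀ᵐ a ∂μ, DifferentiableOn ℂ (fun w => f w a) (ball z ρ))
    (hM : ∀ᵐ a ∂μ, ∀ w ∈ ball z ρ, ‖f w a‖ ≤ M) :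
    Integrable (fun a => fderiv ℂ (fun w => f w a) z) μ ∧
      HasFDerivAt (𝕜 := ℂ) (fun w => ∫ a, f w a ∂μ) (∫ a, fderiv ℂ (fun w => f w a) z ∂μ) z := by
  have hzb : z ∈ ball z ρ := mem_ball_self hρ
  have hρ2 : 0 < ρ / 2 := by positivity
  have hd : ∀ᵐ a ∂μ, HasFDerivAt (fun w => f w a) (fderiv ℂ (fun w => f w a) z) z := by
    filter_upwards [hdiff] with a ha
    exact ((ha z hzb).differentiableAt (isOpen_ball.mem_nhds hzb)).hasFDerivAt
  have hmeas' : AEStronglyMeasurable (fun a => fderiv ℂ (fun w => f w a) z) μ := by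
    have hi : ∀ i : Fin n, AEStronglyMeasurable
        (fun a => fderiv ℂ (fun w => f w a) z (Pi.single i 1)) μ := by
      intro i
      obtain ⟨N, hN⟩ := exists_nat_gt (1 / ρ)
      have hNpos : (0 : ℝ) < N := lt_trans (by positivity) hN
      have hbase : Tendsto (fun k : ℕ => ((k : ℝ) + N)) atTop atTop :=
        tendsto_natCast_atTop_atTop.atTop_add tendsto_const_nhds
      have hmem : ∀ k : ℕ,
          z + (((k : ℂ) + N)⁻¹) • (Pi.single i 1 : Fin n → ℂ) ∈ ball z ρ := by
        intro k
        have : ‖(k : ℂ) + N‖ = (k : ℝ) + N := by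
          rw [← Nat.cast_add, Complex.norm_natCast]; push_cast; rfl
        rw [mem_ball_iff_norm, add_sub_cancel_left, norm_smul, norm_inv, this, Pi.norm_single,
          norm_one, mul_one, inv_lt_comm₀ (by positivity) hρ, ← one_div]
        exact hN.trans_le (by simp)
      refine aestronglyMeasurable_of_tendsto_ae (u := atTop)
        (f := fun (k : ℕ) a => ((k : ℂ) + N) •
          (f (z + (((k : ℂ) + N)⁻¹) • (Pi.single i 1 : Fin n → ℂ)) a - f z a)) ?_ ?_
      · intro k
        exact ((hmeas _ (hmem k)).sub (hmeas z hzb)).const_smul _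
      · filter_upwards [hd] with a ha
        refine ha.lim (c := fun k : ℕ => (k : ℂ) + N) (l := atTop) _ ?_
        refine hbase.congr fun k => ?_
        rw [← Nat.cast_add, ← Nat.cast_add, Complex.norm_natCast]
    have : (fun a => fderiv ℂ (fun w => f w a) z) = fun a => ∑ i,
        (ContinuousLinearMap.proj (R := ℂ) (φ := fun _ : Fin n => ℂ) i).smulRight
          (fderiv ℂ (fun w => f w a) z (Pi.single i 1)) := by
      funext a
      exact clm_eq_sum_smulRight _
    rw [this]
    refine Finset.aestronglyMeasurable_fun_sum _ fun i _ => ?_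
    have hc := (ContinuousLinearMap.smulRightL ℂ (Fin n → ℂ) F
      (ContinuousLinearMap.proj (R := ℂ) (φ := fun _ : Fin n => ℂ) i)).continuous
    exact hc.comp_aestronglyMeasurable (hi i)
  refine hasFDerivAt_integral_of_dominated_loc_of_lip (bound := fun _ => M / (ρ / 2))
    (ball_mem_nhds z hρ2) ?_ ?_ hmeas' ?_ (integrable_const _) hd
  · filter_upwards [ball_mem_nhds z hρ] with w hw using hmeas w hw
  · refine Integrable.of_bound (hmeas z hzb) M ?_
    filter_upwards [hM] with a ha using ha z hzb
  · filter_upwards [hM, hdiff] with a ha hda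
    have hM0 : 0 ≤ M := (norm_nonneg _).trans (ha z hzb)
    refine LipschitzOnWith.of_dist_le_mul fun x hx y hy => ?_
    rw [dist_eq_norm, dist_eq_norm, Real.coe_nnabs, abs_of_nonneg (by positivity)]
    have hsub : ∀ w ∈ ball z (ρ / 2), ball w (ρ / 2) ⊆ ball z ρ := fun w hw =>
      ball_subset_ball' (by have := mem_ball.1 hw; linarith)
    refine (convex_ball z (ρ / 2)).norm_image_sub_le_of_norm_fderiv_le (𝕜 := ℂ)
      (f := fun w => f w a) (fun w hw => ?_) (fun w hw => ?_) hy hx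
    · exact (hda w (hsub w hw (mem_ball_self hρ2))).differentiableAt
        (isOpen_ball.mem_nhds (hsub w hw (mem_ball_self hρ2)))
    · exact norm_fderiv_le_of_ball hρ2 (hda.mono (hsub w hw)) fun u hu => ha u (hsub w hw hu)

/-- The derivative of a holomorphic map of several variables is holomorphic: its components are
given by Cauchy's integral formula on small circles in the coordinate directions. -/
theorem differentiableOn_fderiv [CompleteSpace F] {U : Set (Fin n → ℂ)} (hU : IsOpen U)
    {f : (Fin n → ℂ) → F} (hf : DifferentiableOn ℂ f U) :
    DifferentiableOn ℂ (fderiv ℂ f) U := by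
  intro z hz
  refine DifferentiableAt.differentiableWithinAt ?_
  have hcont : ContinuousAt f z := (hf.continuousOn.continuousAt (hU.mem_nhds hz))
  obtain ⟨ρ, hρ, hball⟩ : ∃ ρ > 0, ∀ w ∈ ball z ρ, w ∈ U ∧ ‖f w‖ < ‖f z‖ + 1 :=
    Metric.eventually_nhds_iff_ball.1
      ((hU.eventually_mem hz).and (hcont.norm.eventually_lt_const (lt_add_one _)))
  set M := ‖f z‖ + 1 with hMdef
  set R := ρ / 4 with hR
  have hR0 : 0 < R := by positivity
  have hi : ∀ i : Fin n, DifferentiableAt ℂ (fun w => fderiv ℂ f w (Pi.single i 1)) z := by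
    intro i
    set v : Fin n → ℂ := Pi.single i 1 with hv
    have hv1 : ‖v‖ = 1 := by rw [hv, Pi.norm_single, norm_one]
    have hmem : ∀ w ∈ ball z (ρ / 2), ∀ ζ ∈ ball (0 : ℂ) (ρ / 2), w + ζ • v ∈ ball z ρ := by
      intro w hw ζ hζ
      rw [mem_ball_iff_norm] at hw ⊢
      rw [mem_ball_zero_iff] at hζ
      calc ‖w + ζ • v - z‖ = ‖(w - z) + ζ • v‖ := by congr 1; abel
        _ ≤ ‖w - z‖ + ‖ζ • v‖ := norm_add_le _ _
        _ < ρ / 2 + ρ / 2 := by rw [norm_smul, hv1, mul_one]; exact add_lt_add hw hζ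
        _ = ρ := by ring
    have hcirc : ∀ θ : ℝ, circleMap 0 R θ ∈ ball (0 : ℂ) (ρ / 2) := fun θ => by
      have := circleMap_mem_sphere (0 : ℂ) hR0.le θ
      rw [mem_sphere_zero_iff_norm] at this
      rw [mem_ball_zero_iff, this, hR]; linarith
    have hformula : ∀ w ∈ ball z (ρ / 2), fderiv ℂ f w v = (2 * Real.pi * Complex.I : ℂ)⁻¹ •
        ∫ θ in Ioc 0 (2 * Real.pi), deriv (circleMap 0 R) θ •
          (((circleMap 0 R θ - 0) ^ 2)⁻¹ • f (w + circleMap 0 R θ • v)) := by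
      intro w hw
      have hder : ∀ ζ ∈ ball (0 : ℂ) (ρ / 2),
          HasDerivAt (fun ζ : ℂ => f (w + ζ • v)) (fderiv ℂ f (w + ζ • v) v) ζ := by
        intro ζ hζ
        have h1 := ((hf _ (hball _ (hmem w hw ζ hζ)).1).differentiableAt
          (hU.mem_nhds (hball _ (hmem w hw ζ hζ)).1)).hasFDerivAt
        have h2 : HasDerivAt (fun ζ : ℂ => w + ζ • v) v ζ := by
          simpa using ((hasDerivAt_id ζ).smul_const v).const_add w
        exact h1.comp_hasDerivAt ζ h2
      have hsub : closedBall (0 : ℂ) R ⊆ ball 0 (ρ / 2) :=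
        closedBall_subset_ball (by rw [hR]; linarith)
      have h := Complex.two_pi_I_inv_smul_circleIntegral_sub_sq_inv_smul_of_differentiable
        (f := fun ζ : ℂ => f (w + ζ • v)) isOpen_ball hsub
        (fun ζ hζ => (hder ζ hζ).differentiableAt.differentiableWithinAt) (mem_ball_self hR0)
      rw [(hder 0 (mem_ball_self (by positivity))).deriv] at h
      simp only [zero_smul, add_zero] at h
      rw [← h, circleIntegral, intervalIntegral.integral_of_le Real.two_pi_pos.le]
    have hint := (hasFDerivAt_integral_of_ball (μ := volume.restrict (Ioc 0 (2 * Real.pi)))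
      (f := fun w (θ : ℝ) => deriv (circleMap 0 R) θ •
          (((circleMap 0 R θ - 0) ^ 2)⁻¹ • f (w + circleMap 0 R θ • v)))
      (z := z) (ρ := ρ / 2) (M := R * ((R ^ 2)⁻¹ * M)) (by positivity) ?_ ?_ ?_).2
    · have hsm := hint.differentiableAt.const_smul (2 * Real.pi * Complex.I : ℂ)⁻¹
      refine hsm.congr_of_eventuallyEq ?_
      filter_upwards [ball_mem_nhds z (by positivity : 0 < ρ / 2)] with w hw using hformula w hw
    · intro w hw
      have hc : Continuous (fun θ : ℝ => f (w + circleMap 0 R θ • v)) := by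
        refine hf.continuousOn.comp_continuous (by fun_prop) fun θ =>
          (hball _ (hmem w hw _ (hcirc θ))).1
      have h2 : Continuous (fun θ : ℝ => ((circleMap 0 R θ - 0) ^ 2)⁻¹) := by
        refine Continuous.inv₀ (by fun_prop) fun θ => ?_
        simp [hR0.ne']
      have h3 : Continuous (deriv (circleMap 0 R)) := by
        have : deriv (circleMap 0 R) = fun θ => circleMap 0 R θ * Complex.I := by
          funext θ; simp
        rw [this]; fun_prop
      exact (h3.smul (h2.smul hc)).aestronglyMeasurable
    · refine Eventually.of_forall fun θ w hw => ?_
      refine DifferentiableAt.differentiableWithinAt ?_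
      refine DifferentiableAt.const_smul (DifferentiableAt.const_smul ?_ _) _
      have hw' := (hball _ (hmem w hw _ (hcirc θ))).1
      exact ((hf _ hw').differentiableAt (hU.mem_nhds hw')).comp (f := fun w => w + _) w
        (by fun_prop)
    · refine Eventually.of_forall fun θ w hw => ?_
      rw [norm_smul, norm_smul, deriv_circleMap]
      simp only [sub_zero, norm_mul, norm_inv, norm_pow, norm_circleMap_zero, Complex.norm_I,
        mul_one, abs_of_pos hR0]
      gcongr
      exact (hball _ (hmem w hw _ (hcirc θ))).2.le
  have : fderiv ℂ f = fun w => ∑ i,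
      ContinuousLinearMap.smulRightL ℂ (Fin n → ℂ) F
        (ContinuousLinearMap.proj (R := ℂ) (φ := fun _ : Fin n => ℂ) i)
        (fderiv ℂ f w (Pi.single i 1)) := by
    funext w
    exact clm_eq_sum_smulRight _
  rw [this]
  exact DifferentiableAt.fun_sum fun i _ =>
    (ContinuousLinearMap.differentiableAt _).comp z (hi i)

end Holomorphic

/-! ### Flows of vector fields -/

section Flow

/-- The Picard–Lindelöf theorem on `[0, 1]`, with the information that the solution stays in the ball
on which the hypotheses hold. -/
theorem exists_integralCurve_mem_closedBall {E : Type*} [NormedAddCommGroup E] [NormedSpace ℝ E]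
    [CompleteSpace E] {f : ℝ → E → E} {x₀ : E} {a L K : ℝ} (ha : 0 ≤ a) (hK : 0 ≤ K)
    (hlip : ∀ t ∈ Icc (0 : ℝ) 1, ∀ x ∈ closedBall x₀ a, ∀ y ∈ closedBall x₀ a,
      ‖f t x - f t y‖ ≤ K * ‖x - y‖)
    (hcont : ∀ x ∈ closedBall x₀ a, ContinuousOn (fun t => f t x) (Icc 0 1))
    (hbound : ∀ t ∈ Icc (0 : ℝ) 1, ∀ x ∈ closedBall x₀ a, ‖f t x‖ ≤ L) (hL : L ≤ a) :
    ∃ c : ℝ → E, c 0 = x₀ ∧ ∀ t ∈ Icc (0 : ℝ) 1, c t ∈ closedBall x₀ a ∧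
      HasDerivWithinAt c (f t (c t)) (Icc 0 1) t := by
  have hL0 : 0 ≤ L := (norm_nonneg _).trans
    (hbound 0 (left_mem_Icc.2 zero_le_one) x₀ (mem_closedBall_self ha))
  let t₀ : Icc (0 : ℝ) 1 := ⟨0, left_mem_Icc.2 zero_le_one⟩
  lift a to NNReal using ha
  lift L to NNReal using hL0
  lift K to NNReal using hK
  have hf : IsPicardLindelof f t₀ x₀ a 0 L K :=
    { lipschitzOnWith := fun t ht => LipschitzOnWith.of_dist_le_mul fun x hx y hy => by
        rw [dist_eq_norm, dist_eq_norm]; exact hlip t ht x hx y hy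
      continuousOn := hcont
      norm_le := hbound
      mul_max_le := by simpa [t₀] using hL }
  have hx : x₀ ∈ closedBall x₀ ((0 : NNReal) : ℝ) := by simp
  obtain ⟨α, hα⟩ := ODE.FunSpace.exists_isFixedPt_next hf hx
  have hmem : ∀ t, α.compProj t ∈ closedBall x₀ a := fun t =>
    α.compProj_mem_closedBall (a := a) hf.mul_max_le
  have heq : ∀ t ∈ Icc (0 : ℝ) 1, α.compProj t = ODE.picard f 0 x₀ α.compProj t := by
    intro t ht
    conv_lhs => rw [← hα]
    rw [ODE.FunSpace.compProj_apply, ODE.FunSpace.next_apply, projIcc_of_mem _ ht]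
  refine ⟨α.compProj, ?_, fun t ht => ⟨hmem t, ?_⟩⟩
  · rw [heq 0 (left_mem_Icc.2 zero_le_one), ODE.picard_apply₀]
  · have h := ODE.hasDerivWithinAt_picard_Icc (α := α.compProj) t₀.2 hf.continuousOn_uncurry
      α.continuous_compProj.continuousOn (fun t _ => hmem t) x₀ ht
    exact h.congr (fun t ht => heq t ht) (heq t ht)

variable {E : Type*} [NormedAddCommGroup E] [NormedSpace ℂ E]

/-- The linear equation `W' = A W`, `W 0 = 1` with a small coefficient `A` is solvable on `[0, 1]`
and its solution stays close to the identity. -/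
theorem exists_linear_flow [CompleteSpace E] {A : ℝ → E →L[ℂ] E} {K : ℝ} (hK : 0 ≤ K)
    (hK4 : K ≤ 1 / 4) (hA : ContinuousOn A (Icc 0 1)) (hAK : ∀ t ∈ Icc (0 : ℝ) 1, ‖A t‖ ≤ K) :
    ∃ W : ℝ → E →L[ℂ] E, W 0 = ContinuousLinearMap.id ℂ E ∧ ∀ t ∈ Icc (0 : ℝ) 1,
      ‖W t - ContinuousLinearMap.id ℂ E‖ ≤ 4 / 3 * K ∧
        HasDerivWithinAt W ((A t).comp (W t)) (Icc 0 1) t := by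
  have hbound : ∀ t ∈ Icc (0 : ℝ) 1, ∀ x ∈ closedBall (ContinuousLinearMap.id ℂ E) (4 / 3 * K),
      ‖(A t).comp x‖ ≤ 4 / 3 * K := by
    intro t ht x hx
    have h1 : ‖x‖ ≤ 1 + 4 / 3 * K := by
      have h2 : ‖x - ContinuousLinearMap.id ℂ E‖ ≤ 4 / 3 * K := by
        simpa [dist_eq_norm] using hx
      calc ‖x‖ = ‖ContinuousLinearMap.id ℂ E + (x - ContinuousLinearMap.id ℂ E)‖ := by
            congr 1; abel
        _ ≤ _ := norm_add_le _ _
        _ ≤ _ := add_le_add ContinuousLinearMap.norm_id_le h2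
    calc ‖(A t).comp x‖ ≤ ‖A t‖ * ‖x‖ := ContinuousLinearMap.opNorm_comp_le _ _
      _ ≤ K * (1 + 4 / 3 * K) := by gcongr; exact hAK t ht
      _ ≤ 4 / 3 * K := by nlinarith
  obtain ⟨W, hW0, hW⟩ := exists_integralCurve_mem_closedBall
    (f := fun t (W : E →L[ℂ] E) => (A t).comp W) (by positivity) hK
    (fun t ht x _ y _ => by
      rw [← ContinuousLinearMap.comp_sub]
      exact (ContinuousLinearMap.opNorm_comp_le _ _).trans
        (mul_le_mul_of_nonneg_right (hAK t ht) (norm_nonneg _)))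
    (fun x _ => hA.clm_comp continuousOn_const) hbound le_rfl
  exact ⟨W, hW0, fun t ht => ⟨by simpa [dist_eq_norm] using (hW t ht).1, (hW t ht).2⟩⟩

theorem hasDerivWithinAt_Ici_of_Icc {E : Type*} [NormedAddCommGroup E] [NormedSpace ℝ E]
    {c : ℝ → E} {c' : E} {t : ℝ} (ht : t ∈ Ico (0 : ℝ) 1)
    (h : HasDerivWithinAt c c' (Icc 0 1) t) : HasDerivWithinAt c c' (Ici t) t :=
  h.mono_of_mem_nhdsWithin (Icc_mem_nhdsGE_of_mem ht)

theorem norm_sub_sub_fderiv_le {D : Set E} (hD : Convex ℝ D) {V : E → E} {V' : E → E →L[ℂ] E}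
    {K₂ : ℝ} (hK₂ : 0 ≤ K₂) (hV : ∀ x ∈ D, HasFDerivAt V (V' x) x)
    (hV₂ : ∀ x ∈ D, ∀ y ∈ D, ‖V' x - V' y‖ ≤ K₂ * ‖x - y‖) {x y : E} (hx : x ∈ D) (hy : y ∈ D) :
    ‖V y - V x - V' x (y - x)‖ ≤ K₂ * ‖y - x‖ ^ 2 := by
  have hseg : segment ℝ x y ⊆ D := hD.segment_subset hx hy
  have := (convex_segment x y).norm_image_sub_le_of_norm_hasFDerivWithin_le' (𝕜 := ℂ) (f := V)
    (φ := V' x) (C := K₂ * ‖y - x‖) (fun w hw => (hV w (hseg hw)).hasFDerivWithinAt)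
    (fun w hw => (hV₂ w (hseg hw) x hx).trans
      (by gcongr; exact norm_sub_le_of_mem_segment hw))
    (left_mem_segment ℝ x y) (right_mem_segment ℝ x y)
  calc _ ≤ _ := this
    _ = _ := by ring

/-- The time-one map of a `C^{1,1}` vector field is differentiable, and its derivative is the
solution of the variational equation: the error is quadratic by Grönwall's inequality. -/
theorem hasFDerivAt_timeOne {D : Set E} (hD : Convex ℝ D) {V φ : E → E} {V' : E → E →L[ℂ] E}
    {K K₂ : ℝ} (hK : 0 ≤ K) (hK₂ : 0 ≤ K₂) (hV : ∀ x ∈ D, HasFDerivAt V (V' x) x)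
    (hVK : ∀ x ∈ D, ‖V' x‖ ≤ K) (hV₂ : ∀ x ∈ D, ∀ y ∈ D, ‖V' x - V' y‖ ≤ K₂ * ‖x - y‖)
    {z₀ : E} {c₀ : ℝ → E} (hc0 : c₀ 0 = z₀) (hc1 : c₀ 1 = φ z₀)
    (hc : ∀ t ∈ Icc (0 : ℝ) 1, c₀ t ∈ D ∧ HasDerivWithinAt c₀ (V (c₀ t)) (Icc 0 1) t)
    (hφ : ∀ᶠ z in 𝓝 z₀, ∃ c : ℝ → E, c 0 = z ∧ c 1 = φ z ∧
      ∀ t ∈ Icc (0 : ℝ) 1, c t ∈ D ∧ HasDerivWithinAt c (V (c t)) (Icc 0 1) t)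
    {W : ℝ → E →L[ℂ] E} (hW0 : W 0 = ContinuousLinearMap.id ℂ E)
    (hW : ∀ t ∈ Icc (0 : ℝ) 1, HasDerivWithinAt W ((V' (c₀ t)).comp (W t)) (Icc 0 1) t) :
    HasFDerivAt φ (W 1) z₀ := by
  have hsub : Ico (0 : ℝ) 1 ⊆ Icc 0 1 := Ico_subset_Icc_self
  have hlip : ∀ x ∈ D, ∀ y ∈ D, ‖V x - V y‖ ≤ K * ‖x - y‖ := fun x hx y hy =>
    hD.norm_image_sub_le_of_norm_hasFDerivWithin_le (𝕜 := ℂ)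
      (fun w hw => (hV w hw).hasFDerivWithinAt) hVK hy hx
  -- Grönwall's inequality with `K + 1` instead of `K` avoids the case distinction `K = 0`.
  set B : ℝ := K₂ * Real.exp K ^ 2 / (K + 1) * (Real.exp (K + 1) - 1) with hB
  have key : ∀ᶠ z in 𝓝 z₀, ‖φ z - φ z₀ - W 1 (z - z₀)‖ ≤ B * ‖‖z - z₀‖ ^ 2‖ := by
    filter_upwards [hφ] with z ⟨c, hcz, hcφ, hcD⟩
    have hcc : ContinuousOn c (Icc 0 1) := fun t ht => (hcD t ht).2.continuousWithinAt
    have hcc₀ : ContinuousOn c₀ (Icc 0 1) := fun t ht => (hc t ht).2.continuousWithinAt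
    have hWc : ContinuousOn W (Icc 0 1) := fun t ht => (hW t ht).continuousWithinAt
    have hdist : ∀ t ∈ Icc (0 : ℝ) 1, ‖c t - c₀ t‖ ≤ ‖z - z₀‖ * Real.exp K := by
      intro t ht
      have h := dist_le_of_trajectories_ODE_of_mem (v := fun _ => V) (s := fun _ => D)
        (K := K.toNNReal) (δ := ‖z - z₀‖) (f := c) (g := c₀) (a := 0) (b := 1)
        (fun t _ => LipschitzOnWith.of_dist_le_mul fun x hx y hy => by
          rw [dist_eq_norm, dist_eq_norm, Real.coe_toNNReal _ hK]; exact hlip x hx y hy)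
        hcc (fun t ht => hasDerivWithinAt_Ici_of_Icc ht (hcD t (hsub ht)).2)
        (fun t ht => (hcD t (hsub ht)).1)
        hcc₀ (fun t ht => hasDerivWithinAt_Ici_of_Icc ht (hc t (hsub ht)).2)
        (fun t ht => (hc t (hsub ht)).1) (by rw [hcz, hc0, dist_eq_norm]) t ht
      rw [dist_eq_norm, Real.coe_toNNReal _ hK] at h
      refine h.trans ?_
      gcongr
      simpa using mul_le_of_le_one_right hK ht.2
    have hWz : ∀ t ∈ Icc (0 : ℝ) 1, HasDerivWithinAt (fun t => W t (z - z₀))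
        (V' (c₀ t) (W t (z - z₀))) (Icc 0 1) t := by
      intro t ht
      have := ((ContinuousLinearMap.apply ℂ E (z - z₀)).restrictScalars
        ℝ).hasFDerivAt.comp_hasDerivWithinAt t (hW t ht)
      exact this
    have hg := norm_le_gronwallBound_of_norm_deriv_right_le (a := 0) (b := 1)
      (f := fun t => c t - c₀ t - W t (z - z₀)) (δ := 0) (K := K + 1)
      (ε := K₂ * (‖z - z₀‖ * Real.exp K) ^ 2)
      (f' := fun t => V (c t) - V (c₀ t) - V' (c₀ t) (W t (z - z₀)))
      ((hcc.sub hcc₀).sub (fun t ht => (hWz t ht).continuousWithinAt))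
      (fun t ht => hasDerivWithinAt_Ici_of_Icc ht
        (((hcD t (hsub ht)).2.sub (hc t (hsub ht)).2).sub (hWz t (hsub ht))))
      (by simp [hcz, hc0, hW0]) ?_ 1 (right_mem_Icc.2 zero_le_one)
    · rw [gronwallBound_of_K_ne_0 (by positivity), hcφ, hc1] at hg
      refine hg.trans (le_of_eq ?_)
      rw [hB]
      simp only [norm_pow, norm_norm]
      ring_nf
    · intro t ht
      have hT := norm_sub_sub_fderiv_le hD hK₂ hV hV₂ (hc t (hsub ht)).1 (hcD t (hsub ht)).1
      have hd := hdist t (hsub ht)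
      set r := c t - c₀ t - W t (z - z₀) with hr
      have hsplit : V (c t) - V (c₀ t) - V' (c₀ t) (W t (z - z₀)) =
          (V (c t) - V (c₀ t) - V' (c₀ t) (c t - c₀ t)) + V' (c₀ t) r := by
        rw [hr, map_sub _ (c t - c₀ t)]; abel
      rw [hsplit]
      calc _ ≤ ‖V (c t) - V (c₀ t) - V' (c₀ t) (c t - c₀ t)‖ + ‖V' (c₀ t) r‖ := norm_add_le _ _
        _ ≤ K₂ * ‖c t - c₀ t‖ ^ 2 + K * ‖r‖ :=
          add_le_add hT ((V' (c₀ t)).le_of_opNorm_le (hVK _ (hc t (hsub ht)).1) _)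
        _ ≤ K₂ * (‖z - z₀‖ * Real.exp K) ^ 2 + (K + 1) * ‖r‖ := by
          gcongr; linarith
        _ = _ := by ring
  rw [hasFDerivAt_iff_isLittleO]
  exact (Asymptotics.IsBigO.of_bound B key).trans_isLittleO
    (Asymptotics.isLittleO_pow_sub_sub z₀ one_lt_two)

/-- If the derivative of the vector field in the direction `ω` is `g`, then the derivative of the
time-one map in the direction `ω` is `ω + g` up to an error of second order. -/
theorem norm_linear_flow_apply_sub_le {D : Set E} {V' : E → E →L[ℂ] E} {g : E → E} {ω z : E}
    {K G₀ G₁ δ : ℝ} (hK : K ≤ 1) (hVK : ∀ x ∈ D, ‖V' x‖ ≤ K)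
    (hg : ∀ x ∈ D, V' x ω = g x) (hG₀ : ∀ x ∈ D, ‖g x‖ ≤ G₀)
    (hG₁ : ∀ x ∈ D, ‖g x - g z‖ ≤ G₁ * ‖x - z‖) (hG₁0 : 0 ≤ G₁)
    {c : ℝ → E} (hc : ∀ t ∈ Icc (0 : ℝ) 1, c t ∈ D ∧ ‖c t - z‖ ≤ δ)
    {W : ℝ → E →L[ℂ] E} (hW0 : W 0 = ContinuousLinearMap.id ℂ E)
    (hW : ∀ t ∈ Icc (0 : ℝ) 1, HasDerivWithinAt W ((V' (c t)).comp (W t)) (Icc 0 1) t) :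
    ‖W 1 ω - ω - g z‖ ≤ G₁ * δ + 2 * K * G₀ := by
  have hsub : Ico (0 : ℝ) 1 ⊆ Icc 0 1 := Ico_subset_Icc_self
  have h0 : (0 : ℝ) ∈ Icc (0 : ℝ) 1 := left_mem_Icc.2 zero_le_one
  have hK0 : 0 ≤ K := (norm_nonneg _).trans (hVK _ (hc 0 h0).1)
  have hG00 : 0 ≤ G₀ := (norm_nonneg _).trans (hG₀ _ (hc 0 h0).1)
  have hw : ∀ t ∈ Icc (0 : ℝ) 1, HasDerivWithinAt (fun t => W t ω - ω)
      (g (c t) + V' (c t) (W t ω - ω)) (Icc 0 1) t := by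
    intro t ht
    have h : HasDerivWithinAt (fun t => W t ω) (V' (c t) (W t ω)) (Icc 0 1) t :=
      ((ContinuousLinearMap.apply ℂ E ω).restrictScalars
        ℝ).hasFDerivAt.comp_hasDerivWithinAt t (hW t ht)
    convert h.sub_const ω using 1
    rw [map_sub, hg _ (hc t ht).1]; abel
  have hwc : ContinuousOn (fun t => W t ω - ω) (Icc 0 1) :=
    fun t ht => (hw t ht).continuousWithinAt
  have hexp : Real.exp 1 - 1 ≤ 2 := by linarith [Real.exp_one_lt_d9]
  have hwb : ∀ t ∈ Icc (0 : ℝ) 1, ‖W t ω - ω‖ ≤ 2 * G₀ := by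
    intro t ht
    have h := norm_le_gronwallBound_of_norm_deriv_right_le (a := 0) (b := 1) (δ := 0) (K := 1)
      (ε := G₀) hwc (fun t ht => hasDerivWithinAt_Ici_of_Icc ht (hw t (hsub ht)))
      (by simp [hW0]) ?_ t ht
    · rw [gronwallBound_of_K_ne_0 one_ne_zero] at h
      refine h.trans ?_
      simp only [zero_mul, sub_zero, one_mul, zero_add, div_one]
      rw [mul_comm]
      gcongr
      refine le_trans ?_ hexp
      gcongr
      exact ht.2
    · intro t ht
      calc _ ≤ ‖g (c t)‖ + ‖V' (c t) (W t ω - ω)‖ := norm_add_le _ _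
        _ ≤ G₀ + 1 * ‖W t ω - ω‖ := add_le_add (hG₀ _ (hc t (hsub ht)).1)
          ((V' (c t)).le_of_opNorm_le ((hVK _ (hc t (hsub ht)).1).trans hK) _)
        _ = _ := by ring
  have hlast := norm_image_sub_le_of_norm_deriv_le_segment_01'
    (f := fun t => W t ω - ω - t • g z) (f' := fun t => g (c t) + V' (c t) (W t ω - ω) - g z)
    (C := G₁ * δ + 2 * K * G₀) (fun t ht => by
      have h := (hasDerivWithinAt_id t (Icc (0 : ℝ) 1)).smul_const (g z)
      rw [one_smul] at h
      exact (hw t ht).sub h) ?_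
  · simpa [hW0] using hlast
  · intro t ht
    have hct := hc t (hsub ht)
    calc ‖g (c t) + V' (c t) (W t ω - ω) - g z‖
        = ‖(g (c t) - g z) + V' (c t) (W t ω - ω)‖ := by congr 1; abel
      _ ≤ ‖g (c t) - g z‖ + ‖V' (c t) (W t ω - ω)‖ := norm_add_le _ _
      _ ≤ G₁ * δ + K * (2 * G₀) := by
        refine add_le_add ((hG₁ _ hct.1).trans (by gcongr; exact hct.2)) ?_
        exact (V' (c t)).le_of_opNorm_le_of_le (hVK _ hct.1) (hwb t (hsub ht))
      _ = _ := by ring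

/-- An integral curve that starts at a real point of a vector field that is real for real arguments
stays real, by Grönwall's inequality for its imaginary part. -/
theorem im_integralCurve_eq_zero {n : ℕ} {D : Set (Fin n → ℂ)} {V : (Fin n → ℂ) → (Fin n → ℂ)}
    {K : ℝ} (hre : ∀ x : Fin n → ℝ, realVec x ∈ D) (hVre : RealOnReals V)
    (hlip : ∀ x ∈ D, ∀ y ∈ D, ‖V x - V y‖ ≤ K * ‖x - y‖) {c : ℝ → Fin n → ℂ}
    (hc0 : ∀ j, (c 0 j).im = 0)
    (hc : ∀ t ∈ Icc (0 : ℝ) 1, c t ∈ D ∧ HasDerivWithinAt c (V (c t)) (Icc 0 1) t) :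
    ∀ t ∈ Icc (0 : ℝ) 1, ∀ j, (c t j).im = 0 := by
  have hsub : Ico (0 : ℝ) 1 ⊆ Icc 0 1 := Ico_subset_Icc_self
  have hder : ∀ t ∈ Icc (0 : ℝ) 1, HasDerivWithinAt (fun t => fun j => (c t j).im)
      (fun j => (V (c t) j).im) (Icc 0 1) t := by
    intro t ht
    rw [hasDerivWithinAt_pi]
    intro j
    have h := hasDerivWithinAt_pi.1 (hc t ht).2 j
    exact Complex.imCLM.hasFDerivAt.comp_hasDerivWithinAt t h
  have hz := eq_zero_of_abs_deriv_le_mul_abs_self_of_eq_zero_right (a := 0) (b := 1) (K := K)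
    (f := fun t => fun j => (c t j).im) (fun t ht => (hder t ht).continuousWithinAt)
    (fun t ht => hasDerivWithinAt_Ici_of_Icc ht (hder t (hsub ht))) (funext hc0) ?_
  · exact fun t ht j => congrFun (hz t ht) j
  · intro t ht
    set x : Fin n → ℝ := fun j => (c t j).re with hx
    have hsubn : ‖c t - realVec x‖ = ‖fun j => (c t j).im‖ := by
      have : c t - realVec x = fun j => ((c t j).im : ℂ) * Complex.I := by
        funext j
        apply Complex.ext <;> simp [realVec, hx]
      rw [this]
      simp [Pi.norm_def]
    rw [← hsubn]
    refine le_trans ?_ (hlip _ (hc t (hsub ht)).1 _ (hre x))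
    refine (pi_norm_le_iff_of_nonneg (norm_nonneg _)).2 fun j => ?_
    have h1 : (V (c t) j).im = ((V (c t) - V (realVec x)) j).im := by
      simp [hVre x j]
    rw [h1, Real.norm_eq_abs]
    exact (Complex.abs_im_le_norm _).trans (norm_le_pi_norm _ j)

end Flow

/-! ### Diophantine approximation -/

section Arithmetic

theorem distInt_le (y : ℝ) (l : ℤ) : distInt y ≤ |y - l| :=
  ciInf_le ⟨0, by rintro _ ⟨l, rfl⟩; exact abs_nonneg _⟩ l

theorem distLattice_le {m : ℕ} (y : Fin m → ℝ) (l : Fin m → ℤ) :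
    distLattice y ≤ ‖fun j => y j - (l j : ℝ)‖ :=
  ciInf_le (f := fun l : Fin m → ℤ => ‖fun j => y j - (l j : ℝ)‖)
    ⟨0, by rintro _ ⟨l, rfl⟩; exact norm_nonneg _⟩ l

theorem abs_sum_int_mul_le {m : ℕ} (k : Fin m → ℤ) (y : Fin m → ℝ) :
    |∑ j, (k j : ℝ) * y j| ≤ m * ‖k‖ * ‖y‖ := by
  calc |∑ j, (k j : ℝ) * y j| ≤ ∑ j, |(k j : ℝ) * y j| := Finset.abs_sum_le_sum_abs _ _
    _ ≤ ∑ _j : Fin m, ‖k‖ * ‖y‖ := by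
      refine Finset.sum_le_sum fun j _ => ?_
      rw [abs_mul]
      refine mul_le_mul ?_ (norm_le_pi_norm y j) (abs_nonneg _) (norm_nonneg _)
      exact (Int.norm_eq_abs (k j)).symm.le.trans (norm_le_pi_norm k j)
    _ = _ := by simp; ring

theorem one_le_norm_of_ne_zero {m : ℕ} {k : Fin m → ℤ} (hk : k ≠ 0) : 1 ≤ ‖k‖ := by
  obtain ⟨j, hj⟩ := Function.ne_iff.1 hk
  refine le_trans ?_ (norm_le_pi_norm k j)
  rw [Int.norm_eq_abs, ← Int.cast_abs]
  exact_mod_cast Int.one_le_abs hj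

/-- A nonzero integer vector of size at most `q ^ (1 / m)` orthogonal to `l` modulo `q`, by the
pigeonhole principle. -/
theorem exists_dvd_sum_mul {m : ℕ} (hm : 1 ≤ m) {q : ℕ} (hq : 1 ≤ q) (l : Fin m → ℤ) :
    ∃ k : Fin m → ℤ, k ≠ 0 ∧ ‖k‖ ≤ (q : ℝ) ^ (1 / (m : ℝ)) ∧ (q : ℤ) ∣ ∑ j, k j * l j := by
  have : NeZero q := ⟨by omega⟩
  set r : ℝ := (q : ℝ) ^ (1 / (m : ℝ)) with hr
  have hr0 : 0 ≤ r := by positivity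
  set N := ⌊r⌋₊ with hN
  have hcard : Fintype.card (ZMod q) < Fintype.card (Fin m → Fin (N + 1)) := by
    rw [ZMod.card, Fintype.card_fun, Fintype.card_fin, Fintype.card_fin]
    have h1 : r < N + 1 := Nat.lt_floor_add_one r
    have h2 : (q : ℝ) = r ^ m := by
      rw [hr, one_div, Real.rpow_inv_natCast_pow (by positivity) (by omega)]
    have h3 : (q : ℝ) < ((N + 1 : ℕ) : ℝ) ^ m := by
      rw [h2]; push_cast; exact pow_lt_pow_left₀ h1 hr0 (by omega)
    exact_mod_cast h3
  obtain ⟨u, v, huv, he⟩ := Fintype.exists_ne_map_eq_of_card_lt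
    (fun u : Fin m → Fin (N + 1) => ∑ j, ((u j : ℕ) : ZMod q) * (l j : ZMod q)) hcard
  refine ⟨fun j => ((u j : ℕ) : ℤ) - ((v j : ℕ) : ℤ), ?_, ?_, ?_⟩
  · intro h
    refine huv (funext fun j => Fin.ext ?_)
    have := congrFun h j
    simp only [Pi.zero_apply] at this
    omega
  · refine (pi_norm_le_iff_of_nonneg hr0).2 fun j => ?_
    refine le_trans ?_ (Nat.floor_le hr0)
    have h1 := (u j).2
    have h2 := (v j).2
    rw [Int.norm_eq_abs, ← Int.cast_abs]
    have : |((u j : ℕ) : ℤ) - ((v j : ℕ) : ℤ)| ≤ (N : ℤ) := by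
      rw [abs_le]; constructor <;> omega
    exact_mod_cast this
  · rw [← ZMod.intCast_zmod_eq_zero_iff_dvd]
    push_cast
    simp only [sub_mul, Finset.sum_sub_distrib]
    exact sub_eq_zero.2 he

/-- Khintchine's transference principle. -/
theorem LinearDiophantine.simultaneousDiophantine {m : ℕ} (hm : 1 ≤ m) {τ γ : ℝ} (hτ : 0 ≤ τ)
    (hγ : 0 < γ) {x : Fin m → ℝ} (hx : LinearDiophantine τ γ x) :
    SimultaneousDiophantine τ (γ / m) x := by
  intro q hq
  refine le_ciInf fun l => ?_
  obtain ⟨k, hk0, hkq, N, hN⟩ := exists_dvd_sum_mul hm hq l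
  set δ := ‖fun j => (q : ℝ) * x j - (l j : ℝ)‖ with hδ
  have hq0 : (0 : ℝ) < q := by exact_mod_cast hq
  have hm0 : (0 : ℝ) < m := by exact_mod_cast hm
  have hk1 := one_le_norm_of_ne_zero hk0
  have hk1' : 0 < ‖k‖ := by linarith
  have h1 : γ * ‖k‖ ^ (-((1 + τ) * (m : ℝ))) ≤ m * ‖k‖ * δ / q := by
    refine (hx.2 k hk0).trans ((distInt_le _ N).trans ?_)
    have : ∑ j, (k j : ℝ) * x j - N = (∑ j, (k j : ℝ) * ((q : ℝ) * x j - l j)) / q := by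
      have hN' : ∑ j, (k j : ℝ) * (l j : ℝ) = q * N := by exact_mod_cast hN
      simp only [mul_sub, Finset.sum_sub_distrib, hN']
      rw [eq_div_iff hq0.ne', sub_mul, Finset.sum_mul, mul_comm (N : ℝ)]
      congr 1
      exact Finset.sum_congr rfl fun j _ => by ring
    rw [this, abs_div, abs_of_pos hq0]
    gcongr
    exact abs_sum_int_mul_le k _
  have h2 : γ * q ≤ m * δ * ‖k‖ ^ ((1 + τ) * (m : ℝ) + 1) := by
    rw [Real.rpow_neg hk1'.le, le_div_iff₀ hq0] at h1
    rw [Real.rpow_add_one hk1'.ne']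
    have h3 : 0 < ‖k‖ ^ ((1 + τ) * (m : ℝ)) := by positivity
    calc γ * q = (γ * (‖k‖ ^ ((1 + τ) * (m : ℝ)))⁻¹ * q) * ‖k‖ ^ ((1 + τ) * (m : ℝ)) := by
          field_simp
      _ ≤ (m * ‖k‖ * δ) * ‖k‖ ^ ((1 + τ) * (m : ℝ)) := by gcongr
      _ = _ := by ring
  have h4 : ‖k‖ ^ ((1 + τ) * (m : ℝ) + 1) ≤ q * (q : ℝ) ^ ((1 + (m : ℝ) * τ) / (m : ℝ)) := by
    calc ‖k‖ ^ ((1 + τ) * (m : ℝ) + 1)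
        ≤ ((q : ℝ) ^ (1 / (m : ℝ))) ^ ((1 + τ) * (m : ℝ) + 1) := by
          gcongr
      _ = (q : ℝ) ^ (1 + (1 + (m : ℝ) * τ) / (m : ℝ)) := by
          rw [← Real.rpow_mul hq0.le]; congr 1; field_simp; ring
      _ = _ := by rw [Real.rpow_add hq0, Real.rpow_one]
  have hδ0 : 0 ≤ δ := norm_nonneg _
  have h5 : γ * q ≤ m * δ * (q * (q : ℝ) ^ ((1 + (m : ℝ) * τ) / (m : ℝ))) :=
    h2.trans (by gcongr)
  rw [Real.rpow_neg hq0.le, ← div_eq_mul_inv, div_div, div_le_iff₀ (by positivity)]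
  refine le_of_mul_le_mul_right ?_ hq0
  linarith

/-- Dirichlet's theorem on simultaneous approximation, with a real bound `Q`. -/
theorem exists_simultaneous_approx {m : ℕ} (x : Fin m → ℝ) {Q : ℝ} (hQ : 1 ≤ Q) :
    ∃ (q : ℕ) (p : Fin m → ℤ), 1 ≤ q ∧ (q : ℝ) ≤ Q ^ m ∧
      ‖fun j => (q : ℝ) * x j - (p j : ℝ)‖ ≤ Q⁻¹ := by
  have hQ0 : 0 < Q := by linarith
  have hQm : 1 ≤ Q ^ m := one_le_pow₀ hQ
  have hn : 0 < ⌊Q ^ m⌋₊ := Nat.floor_pos.2 hQm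
  obtain ⟨q, hq, hle⟩ := NormedAddCommGroup.exists_norm_nsmul_le (A := Fin m → UnitAddCircle)
    (μ := volume) (fun j => (x j : UnitAddCircle)) hn Q⁻¹ (by
      rw [volume_pi_closedBall _ (by positivity), volume_pi, Measure.pi_univ]
      simp only [AddCircle.measure_univ, AddCircle.volume_closedBall, ENNReal.ofReal_one,
        Finset.prod_const, Finset.card_univ, Fintype.card_fin, one_pow, Pi.zero_apply]
      rw [mul_div_cancel₀ _ two_ne_zero, min_eq_right (inv_le_one_of_one_le₀ hQ),
        ← ENNReal.ofReal_pow (by positivity), ← ENNReal.ofReal_nsmul, ENNReal.one_le_ofReal,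
        nsmul_eq_mul]
      have := (Nat.lt_floor_add_one (Q ^ m)).le
      rw [inv_pow, ← div_eq_mul_inv, one_le_div (by positivity)]
      push_cast
      exact this)
  refine ⟨q, fun j => round ((q : ℝ) * x j), hq.1, (Nat.le_floor_iff (by positivity)).1 hq.2, ?_⟩
  refine (pi_norm_le_iff_of_nonneg (by positivity)).2 fun j => ?_
  refine le_trans (le_of_eq ?_) ((norm_le_pi_norm _ j).trans hle)
  rw [Pi.smul_apply, ← AddCircle.coe_nsmul, UnitAddCircle.norm_eq, nsmul_eq_mul, Real.norm_eq_abs]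

/-- Resonances `k · (q, p) = 0` are of high order, when `p / q` is a good approximation of a
Diophantine vector. -/
theorem gammaStar_mul_le_norm {m : ℕ} (hm : 1 ≤ m) {τ γ γ' : ℝ} (hτ : 0 ≤ τ) (hγ : 0 < γ)
    (hγ' : 0 < γ') {x : Fin m → ℝ} (hx : LinearDiophantine τ γ x)
    (hx' : SimultaneousDiophantine τ γ' x) {Q : ℝ} (hQ : 1 ≤ Q) {q : ℕ} (hq : 1 ≤ q)
    {p : Fin m → ℤ} (hp : ‖fun j => (q : ℝ) * x j - (p j : ℝ)‖ ≤ Q⁻¹)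
    {k : Fin (m + 1) → ℤ} (hk : k ≠ 0) (hkp : (q : ℤ) * k 0 + ∑ j, k j.succ * p j = 0) :
    gammaStar (m + 1) τ γ γ' * Q ^ (1 / aConst (m + 1) τ) ≤ ‖k‖ := by
  have hQ0 : 0 < Q := by linarith
  have hq0 : (0 : ℝ) < q := by exact_mod_cast hq
  have hm0 : (0 : ℝ) < m := by exact_mod_cast hm
  set κ : Fin m → ℤ := fun j => k j.succ with hκ
  have hκ0 : κ ≠ 0 := by
    intro h
    have h0 : ∀ j : Fin m, k j.succ = 0 := fun j => congrFun h j
    simp only [h0, zero_mul, Finset.sum_const_zero, add_zero, mul_eq_zero] at hkp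
    refine hk (funext fun j => ?_)
    refine Fin.cases ?_ h0 j
    rcases hkp with h | h
    · omega
    · exact h
  have hκk : ‖κ‖ ≤ ‖k‖ := (pi_norm_le_iff_of_nonneg (norm_nonneg _)).2 fun j =>
    norm_le_pi_norm k j.succ
  have hκ1 := one_le_norm_of_ne_zero hκ0
  have hκ1' : 0 < ‖κ‖ := by linarith
  set a : ℝ := 1 + m * τ with ha
  have ha0 : 0 < a := by positivity
  have haC : aConst (m + 1) τ = a := by rw [aConst, ha]; push_cast; ring
  -- the denominator `q` is not too small
  have hqlow : (γ' * Q) ^ (m / a) ≤ q := by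
    have h1 := (hx' q hq).trans ((distLattice_le _ p).trans hp)
    rw [Real.rpow_neg hq0.le] at h1
    have h2 : γ' * Q ≤ (q : ℝ) ^ (a / m) := by
      have h3 : 0 < (q : ℝ) ^ (a / m) := by positivity
      have h4 := mul_le_mul_of_nonneg_right h1 (mul_pos h3 hQ0).le
      calc γ' * Q = γ' * ((q : ℝ) ^ (a / m))⁻¹ * ((q : ℝ) ^ (a / m) * Q) := by field_simp
        _ ≤ _ := h4
        _ = _ := by field_simp
    calc (γ' * Q) ^ (m / a) ≤ ((q : ℝ) ^ (a / m)) ^ (m / a) := by gcongr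
      _ = q := by
        rw [← Real.rpow_mul hq0.le, div_mul_div_cancel₀ hm0.ne', div_self ha0.ne', Real.rpow_one]
  have h1 : γ * ‖κ‖ ^ (-((1 + τ) * (m : ℝ))) ≤ m * ‖κ‖ * Q⁻¹ / q := by
    refine (hx.2 κ hκ0).trans ((distInt_le _ (-k 0)).trans ?_)
    have : ∑ j, (κ j : ℝ) * x j - ((-k 0 : ℤ) : ℝ) =
        (∑ j, (κ j : ℝ) * ((q : ℝ) * x j - p j)) / q := by
      have hN' : (q : ℝ) * k 0 + ∑ j, (κ j : ℝ) * (p j : ℝ) = 0 := by exact_mod_cast hkp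
      simp only [mul_sub, Finset.sum_sub_distrib, eq_neg_of_add_eq_zero_right hN']
      rw [eq_div_iff hq0.ne', sub_mul, Finset.sum_mul]
      push_cast
      rw [neg_mul, mul_comm (k 0 : ℝ)]
      congr 1
      exact Finset.sum_congr rfl fun j _ => by ring
    rw [this, abs_div, abs_of_pos hq0]
    gcongr
    exact (abs_sum_int_mul_le κ _).trans (by gcongr)
  have h2 : γ * (q * Q) ≤ m * ‖κ‖ ^ ((1 + τ) * (m : ℝ) + 1) := by
    rw [Real.rpow_neg hκ1'.le, le_div_iff₀ hq0] at h1
    rw [Real.rpow_add_one hκ1'.ne']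
    have h3 : 0 < ‖κ‖ ^ ((1 + τ) * (m : ℝ)) := by positivity
    calc γ * (q * Q)
        = (γ * (‖κ‖ ^ ((1 + τ) * (m : ℝ)))⁻¹ * q) * (‖κ‖ ^ ((1 + τ) * (m : ℝ)) * Q) := by
          field_simp
      _ ≤ (m * ‖κ‖ * Q⁻¹) * (‖κ‖ ^ ((1 + τ) * (m : ℝ)) * Q) := by gcongr
      _ = _ := by field_simp
  set N : ℝ := (1 + τ) * (m : ℝ) + 1 with hN
  have hN0 : 0 < N := by positivity
  have hbase : 0 ≤ ((m + 1 : ℕ) : ℝ)⁻¹ * γ * γ' ^ (m / a) := by positivity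
  have hgs : gammaStar (m + 1) τ γ γ' = (((m + 1 : ℕ) : ℝ)⁻¹ * γ * γ' ^ (m / a)) ^ (1 / N) := by
    rw [gammaStar, hN, ha]
    push_cast
    congr 2
    · congr 2 <;> ring
    · ring
  have h5 : ((m + 1 : ℕ) : ℝ)⁻¹ * γ * γ' ^ (m / a) * Q ^ (m / a + 1) ≤ ‖k‖ ^ N := by
    calc ((m + 1 : ℕ) : ℝ)⁻¹ * γ * γ' ^ (m / a) * Q ^ (m / a + 1)
        = ((m + 1 : ℕ) : ℝ)⁻¹ * (γ * ((γ' * Q) ^ (m / a) * Q)) := by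
          rw [Real.rpow_add_one hQ0.ne', Real.mul_rpow hγ'.le hQ0.le]; ring
      _ ≤ (m : ℝ)⁻¹ * (γ * (q * Q)) := by
          gcongr
          omega
      _ ≤ (m : ℝ)⁻¹ * (m * ‖κ‖ ^ N) := by gcongr
      _ = ‖κ‖ ^ N := by field_simp
      _ ≤ ‖k‖ ^ N := by gcongr
  rw [hgs, haC, ← Real.rpow_le_rpow_iff (by positivity) (norm_nonneg _) hN0]
  rw [Real.mul_rpow (by positivity) (by positivity), ← Real.rpow_mul hbase,
    ← Real.rpow_mul hQ0.le, one_div_mul_cancel hN0.ne', Real.rpow_one]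
  refine le_trans (le_of_eq ?_) h5
  congr 2
  rw [hN]; field_simp; rw [ha]; ring

end Arithmetic

/-! ### Strips -/

section Strip

variable {n : ℕ}

theorem isOpen_strip (s : ℝ) : IsOpen (strip n s) := by
  have : strip n s = ⋂ j, (fun z : Fin n → ℂ => |(z j).im|) ⁻¹' Iio s := by
    ext z; simp [strip]
  rw [this]
  exact isOpen_iInter_of_finite fun j => isOpen_Iio.preimage (by fun_prop)

theorem convex_strip (s : ℝ) : Convex ℝ (strip n s) := by
  intro z hz w hw a b ha hb hab j
  have h : ((a • z + b • w) j).im = a * (z j).im + b * (w j).im := by simp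
  rw [h]
  have hz' := abs_lt.1 (hz j)
  have hw' := abs_lt.1 (hw j)
  rw [abs_lt]
  constructor
  · rcases ha.eq_or_lt with rfl | ha'
    · obtain rfl : b = 1 := by linarith
      linarith
    · nlinarith
  · rcases ha.eq_or_lt with rfl | ha'
    · obtain rfl : b = 1 := by linarith
      linarith
    · nlinarith

theorem strip_mono {s t : ℝ} (h : s ≤ t) : strip n s ⊆ strip n t := fun _ hz j => (hz j).trans_le h

theorem realVec_mem_strip {s : ℝ} (hs : 0 < s) (x : Fin n → ℝ) : realVec x ∈ strip n s :=
  fun j => by simpa [realVec] using hs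

theorem add_realVec_mem_strip {s : ℝ} {z : Fin n → ℂ} (x : Fin n → ℝ) :
    z + realVec x ∈ strip n s ↔ z ∈ strip n s := by
  simp [strip, realVec]

theorem add_mem_strip {s δ : ℝ} {z w : Fin n → ℂ} (hz : z ∈ strip n (s - δ)) (hw : ‖w - z‖ ≤ δ) :
    w ∈ strip n s := by
  intro j
  have h1 : |(w j - z j).im| ≤ δ :=
    (Complex.abs_im_le_norm _).trans ((norm_le_pi_norm (w - z) j).trans hw)
  have h2 := hz j
  rw [Complex.sub_im, abs_le] at h1
  rw [abs_lt] at h2 ⊢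
  constructor <;> linarith

theorem ball_subset_strip {s δ : ℝ} {z : Fin n → ℂ} (hz : z ∈ strip n (s - δ)) :
    ball z δ ⊆ strip n s := fun _ hw => add_mem_strip hz (mem_ball_iff_norm.1 hw).le

theorem realVec_intCast (k : Fin n → ℤ) : realVec (fun j => (k j : ℝ)) = intVec k := by
  funext j; simp [realVec, intVec]

theorem realVec_add (x y : Fin n → ℝ) : realVec (x + y) = realVec x + realVec y := by
  funext j; simp [realVec]

theorem realVec_smul (t : ℝ) (x : Fin n → ℝ) : realVec (t • x) = (t : ℂ) • realVec x := by
  funext j; simp [realVec]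

theorem norm_realVec (x : Fin n → ℝ) : ‖realVec x‖ = ‖x‖ := by
  simp [Pi.norm_def, realVec]

theorem continuous_realVec : Continuous (realVec (n := n)) := by
  unfold realVec; fun_prop

/-- Cauchy's estimate on strips. -/
theorem norm_fderiv_le_of_strip {F : Type*} [NormedAddCommGroup F] [NormedSpace ℂ F]
    {f : (Fin n → ℂ) → F} {s δ M : ℝ} (hδ : 0 < δ) (hf : DifferentiableOn ℂ f (strip n s))
    (hM : ∀ z ∈ strip n s, ‖f z‖ ≤ M) {z : Fin n → ℂ} (hz : z ∈ strip n (s - δ)) :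
    ‖fderiv ℂ f z‖ ≤ M / δ :=
  norm_fderiv_le_of_ball hδ (hf.mono (ball_subset_strip hz))
    fun w hw => hM w (ball_subset_strip hz hw)

theorem norm_sub_le_of_strip {F : Type*} [NormedAddCommGroup F] [NormedSpace ℂ F]
    {f : (Fin n → ℂ) → F} {s δ M : ℝ} (hδ : 0 < δ) (hf : DifferentiableOn ℂ f (strip n s))
    (hM : ∀ z ∈ strip n s, ‖f z‖ ≤ M) {z w : Fin n → ℂ} (hz : z ∈ strip n (s - δ))
    (hw : w ∈ strip n (s - δ)) : ‖f w - f z‖ ≤ M / δ * ‖w - z‖ :=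
  (convex_strip (s - δ)).norm_image_sub_le_of_norm_fderiv_le (𝕜 := ℂ)
    (fun u hu => (hf u (strip_mono (by linarith) hu)).differentiableAt
      ((isOpen_strip s).mem_nhds (strip_mono (by linarith) hu)))
    (fun _ hu => norm_fderiv_le_of_strip hδ hf hM hu) hz hw

end Strip

/-! ### Functions on the torus -/

section Torus

variable {n : ℕ} {F : Type*}

/-- The normalized Haar measure on the torus `𝕋ⁿ`. -/
noncomputable def torusMeasure (n : ℕ) : Measure (UnitAddTorus (Fin n)) :=
  Measure.pi fun _ => AddCircle.haarAddCircle

instance : IsProbabilityMeasure (torusMeasure n) :=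
  inferInstanceAs (IsProbabilityMeasure (Measure.pi fun _ => AddCircle.haarAddCircle))

instance : (torusMeasure n).IsAddHaarMeasure :=
  inferInstanceAs (Measure.pi fun _ => AddCircle.haarAddCircle).IsAddHaarMeasure

/-- The projection `ℝⁿ → 𝕋ⁿ`. -/
def toTorus (x : Fin n → ℝ) : UnitAddTorus (Fin n) := fun j => (x j : UnitAddCircle)

/-- The function on the torus with the lift `g`; it is meaningful if `g` is `ℤⁿ`-periodic. -/
noncomputable def torusLift (g : (Fin n → ℝ) → F) (θ : UnitAddTorus (Fin n)) : F :=
  g fun j => Quotient.out (θ j)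

theorem isOpenQuotientMap_toTorus : IsOpenQuotientMap (toTorus (n := n)) :=
  IsOpenQuotientMap.piMap fun _ => QuotientAddGroup.isOpenQuotientMap_mk

theorem toTorus_add (x y : Fin n → ℝ) : toTorus (x + y) = toTorus x + toTorus y := rfl

theorem torusLift_toTorus {g : (Fin n → ℝ) → F}
    (hg : ∀ x, ∀ k : Fin n → ℤ, g (x + fun j => (k j : ℝ)) = g x) (x : Fin n → ℝ) :
    torusLift g (toTorus x) = g x := by
  have h : ∀ j, ∃ k : ℤ, (Quotient.out (toTorus x j) : ℝ) = x j + k := by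
    intro j
    have h1 : ((Quotient.out (toTorus x j) : ℝ) : UnitAddCircle) = (x j : UnitAddCircle) :=
      QuotientAddGroup.out_eq' _
    obtain ⟨k, hk⟩ := (QuotientAddGroup.eq_iff_sub_mem.1 h1)
    refine ⟨k, ?_⟩
    simp only [zsmul_eq_mul, mul_one] at hk
    linarith
  choose k hk using h
  rw [torusLift, ← hg x k]
  exact congrArg g (funext hk)

theorem continuous_torusLift [TopologicalSpace F] {g : (Fin n → ℝ) → F} (hc : Continuous g)
    (hg : ∀ x, ∀ k : Fin n → ℤ, g (x + fun j => (k j : ℝ)) = g x) : Continuous (torusLift g) := by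
  rw [← isOpenQuotientMap_toTorus.continuous_comp_iff]
  convert hc using 1
  exact funext (torusLift_toTorus hg)

theorem torusLift_add_toTorus {g : (Fin n → ℝ) → F}
    (hg : ∀ x, ∀ k : Fin n → ℤ, g (x + fun j => (k j : ℝ)) = g x) (r : Fin n → ℝ)
    (θ : UnitAddTorus (Fin n)) :
    torusLift g (θ + toTorus r) = torusLift (fun x => g (x + r)) θ := by
  obtain ⟨x, rfl⟩ := isOpenQuotientMap_toTorus.surjective θ
  rw [← toTorus_add, torusLift_toTorus hg, torusLift_toTorus]
  intro x k
  rw [add_right_comm, hg]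

theorem integral_torusLift_add [NormedAddCommGroup F] [NormedSpace ℝ F] {g : (Fin n → ℝ) → F}
    (hg : ∀ x, ∀ k : Fin n → ℤ, g (x + fun j => (k j : ℝ)) = g x) (r : Fin n → ℝ) :
    ∫ θ, torusLift (fun x => g (x + r)) θ ∂torusMeasure n =
      ∫ θ, torusLift g θ ∂torusMeasure n := by
  simp_rw [← torusLift_add_toTorus hg r]
  exact integral_add_right_eq_self _ _

theorem integral_torusLift [NormedAddCommGroup F] [NormedSpace ℝ F] {g : (Fin n → ℝ) → F}
    (hg : ∀ x, ∀ k : Fin n → ℤ, g (x + fun j => (k j : ℝ)) = g x) :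
    ∫ θ, torusLift g θ ∂torusMeasure n = ∫ x in Icc (0 : Fin n → ℝ) 1, g x := by
  have h := UnitAddTorus.integral_preimage (torusLift g) 0
  refine h.trans ?_
  have hset : {x : Fin n → ℝ | ∀ i, x i ∈ Ioc ((0 : Fin n → ℝ) i) ((0 : Fin n → ℝ) i + 1)} =
      univ.pi fun i => Ioc ((0 : Fin n → ℝ) i) ((1 : Fin n → ℝ) i) := by
    ext x; simp
  rw [hset, volume_pi, setIntegral_congr_set Measure.univ_pi_Ioc_ae_eq_Icc]
  exact integral_congr_ae (Eventually.of_forall fun x => torusLift_toTorus hg x)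

end Torus

/-! ### Fourier coefficients on complex tori -/

section Fourier

variable {n : ℕ}

/-- A periodic holomorphic function on the strip has a holomorphic torus average, which is constant
in the real directions, hence constant. -/
theorem torusAverage_eq {s M : ℝ} {H : (Fin n → ℂ) → ℂ} (hH : DifferentiableOn ℂ H (strip n s))
    (hper : ∀ z ∈ strip n s, ∀ k : Fin n → ℤ, H (z + intVec k) = H z)
    (hM : ∀ z ∈ strip n s, ‖H z‖ ≤ M) {w w' : Fin n → ℂ} (hw : w ∈ strip n s)
    (hw' : w' ∈ strip n s) :
    ∫ θ, torusLift (fun x => H (realVec x + w)) θ ∂torusMeasure n =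
      ∫ θ, torusLift (fun x => H (realVec x + w')) θ ∂torusMeasure n := by
  have hmem : ∀ (x : Fin n → ℝ) {w}, w ∈ strip n s → realVec x + w ∈ strip n s := fun x _ hw => by
    rw [add_comm]; exact (add_realVec_mem_strip x).2 hw
  have hperx : ∀ {w}, w ∈ strip n s → ∀ (x : Fin n → ℝ) (k : Fin n → ℤ),
      H (realVec (x + fun j => (k j : ℝ)) + w) = H (realVec x + w) := by
    intro w hw x k
    rw [realVec_add, realVec_intCast, add_right_comm]
    exact hper _ (hmem x hw) k
  set J : (Fin n → ℂ) → ℂ := fun w =>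
    ∫ θ, torusLift (fun x => H (realVec x + w)) θ ∂torusMeasure n with hJ
  have hJd : ∀ w ∈ strip n s, DifferentiableAt ℂ J w := by
    intro w hw
    obtain ⟨ρ, hρ, hball⟩ := Metric.isOpen_iff.1 (isOpen_strip s) w hw
    refine (hasFDerivAt_integral_of_ball (μ := torusMeasure n)
      (f := fun w θ => torusLift (fun x => H (realVec x + w)) θ) (M := M) hρ
      (fun u hu => ?_) (Eventually.of_forall fun θ u hu => ?_)
      (Eventually.of_forall fun θ u hu => hM _ (hmem _ (hball hu)))).2.differentiableAt
    · refine (continuous_torusLift ?_ (hperx (hball hu))).aestronglyMeasurable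
      exact hH.continuousOn.comp_continuous (continuous_realVec.add continuous_const)
        fun x => hmem x (hball hu)
    · refine DifferentiableAt.differentiableWithinAt ?_
      exact ((hH _ (hmem _ (hball hu))).differentiableAt
        ((isOpen_strip s).mem_nhds (hmem _ (hball hu)))).comp (f := fun u => _ + u) u
          (by fun_prop)
  have hJr : ∀ w ∈ strip n s, ∀ r : Fin n → ℝ, J (w + realVec r) = J w := by
    intro w hw r
    have h := integral_torusLift_add (g := fun x => H (realVec x + w)) (hperx hw) r
    simp only [realVec_add] at h
    simp only [hJ]
    rw [← h]
    congr 1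
    funext θ
    simp only [torusLift]
    congr 1
    abel
  have hJ0 : ∀ w ∈ strip n s, fderiv ℂ J w = 0 := by
    intro w hw
    have hi : ∀ i : Fin n, fderiv ℂ J w (Pi.single i 1) = 0 := by
      intro i
      have hcurve : HasDerivAt (fun t : ℝ => w + realVec (t • (Pi.single i 1 : Fin n → ℝ)))
          (Pi.single i 1 : Fin n → ℂ) 0 := by
        have h1 : (fun t : ℝ => w + realVec (t • (Pi.single i 1 : Fin n → ℝ))) =
            fun t : ℝ => w + t • (Pi.single i 1 : Fin n → ℂ) := by
          funext t j
          by_cases hj : j = i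
          · subst hj; simp [realVec]
          · simp [realVec, hj]
        rw [h1]
        simpa using ((hasDerivAt_id (0 : ℝ)).smul_const (Pi.single i 1 : Fin n → ℂ)).const_add w
      have h0 : w + realVec ((0 : ℝ) • (Pi.single i 1 : Fin n → ℝ)) = w := by
        funext j; simp [realVec]
      have h2 : HasDerivAt (fun t : ℝ => J (w + realVec (t • (Pi.single i 1 : Fin n → ℝ))))
          (fderiv ℂ J w (Pi.single i 1)) 0 := by
        have h3 := (hJd w hw).hasFDerivAt.restrictScalars ℝ
        rw [← h0] at h3
        have := h3.comp_hasDerivAt (0 : ℝ) hcurve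
        rw [h0] at this
        exact this
      have h4 : (fun t : ℝ => J (w + realVec (t • (Pi.single i 1 : Fin n → ℝ)))) =
          fun _ => J w := funext fun t => hJr w hw _
      rw [h4] at h2
      exact h2.unique (hasDerivAt_const _ _)
    rw [clm_eq_sum_smulRight (fderiv ℂ J w)]
    simp [hi]
  exact (convex_strip s).is_const_of_fderivWithin_eq_zero (𝕜 := ℂ) (f := J)
    (fun u hu => (hJd u hu).differentiableWithinAt)
    (fun u hu => by rw [fderivWithin_of_isOpen (isOpen_strip s) hu, hJ0 u hu]) hw hw'

/-- The `k`-th Fourier coefficient of the function `x ↦ f (x + w)` on the torus. -/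
noncomputable def torusCoeff (f : (Fin n → ℂ) → ℂ) (w : Fin n → ℂ) (k : Fin n → ℤ) : ℂ :=
  UnitAddTorus.mFourierCoeff (torusLift fun x => f (realVec x + w)) k

/-- The character `e^{2πi k·z}`. -/
noncomputable def character (k : Fin n → ℤ) (z : Fin n → ℂ) : ℂ :=
  Complex.exp (2 * Real.pi * Complex.I * ∑ j, (k j : ℂ) * z j)

theorem character_add (k : Fin n → ℤ) (z w : Fin n → ℂ) :
    character k (z + w) = character k z * character k w := by
  rw [character, character, character, ← Complex.exp_add, ← mul_add, ← Finset.sum_add_distrib]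
  simp [mul_add]

theorem character_neg_mul (k : Fin n → ℤ) (z : Fin n → ℂ) :
    character k z * character (-k) z = 1 := by
  rw [character, character, ← Complex.exp_add]
  simp

theorem character_intVec (k l : Fin n → ℤ) : character k (intVec l) = 1 := by
  rw [character, Complex.exp_eq_one_iff]
  refine ⟨∑ j, k j * l j, ?_⟩
  simp only [intVec]
  push_cast
  ring

theorem norm_character (k : Fin n → ℤ) (z : Fin n → ℂ) :
    ‖character k z‖ = Real.exp (-(2 * Real.pi * ∑ j, (k j : ℝ) * (z j).im)) := by
  rw [character, Complex.norm_exp]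
  congr 1
  simp [Complex.mul_re, Complex.mul_im, Finset.mul_sum]

theorem mFourier_toTorus (k : Fin n → ℤ) (x : Fin n → ℝ) :
    UnitAddTorus.mFourier k (toTorus x) = character k (realVec x) := by
  rw [UnitAddTorus.mFourier, character, ContinuousMap.coe_mk, Finset.mul_sum, Complex.exp_sum]
  refine Finset.prod_congr rfl fun j _ => ?_
  rw [toTorus, fourier_coe_apply]
  congr 1
  simp [realVec]
  ring

/-- The Fourier coefficient is the character times a torus average of a holomorphic function, to which
`torusAverage_eq` applies. -/
theorem torusCoeff_eq {s : ℝ} {f : (Fin n → ℂ) → ℂ}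
    (hper : ∀ z ∈ strip n s, ∀ k : Fin n → ℤ, f (z + intVec k) = f z) {w : Fin n → ℂ}
    (hw : w ∈ strip n s) (k : Fin n → ℤ) :
    torusCoeff f w k = character k w *
      ∫ θ, torusLift (fun x => (fun z => character (-k) z * f z) (realVec x + w)) θ
        ∂torusMeasure n := by
  rw [← integral_const_mul]
  refine integral_congr_ae (Eventually.of_forall fun θ => ?_)
  obtain ⟨x, rfl⟩ := isOpenQuotientMap_toTorus.surjective θ
  have hmem : ∀ x : Fin n → ℝ, realVec x + w ∈ strip n s := fun x => by
    rw [add_comm]; exact (add_realVec_mem_strip x).2 hw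
  simp only [smul_eq_mul]
  rw [mFourier_toTorus, torusLift_toTorus, torusLift_toTorus]
  · rw [character_add]
    linear_combination (-character (-k) (realVec x) * f (realVec x + w)) * character_neg_mul k w
  · intro x l
    simp only [realVec_add, realVec_intCast]
    rw [add_right_comm, hper _ (hmem x), character_add _ _ (intVec l), character_intVec, mul_one]
  · intro x l
    simp only [realVec_add, realVec_intCast]
    rw [add_right_comm, hper _ (hmem x)]

end Fourier

/-! ### Decay of Fourier coefficients -/

section Decay

variable {n : ℕ}

/-- Decay of the Fourier coefficients, by moving the torus of integration in the imaginary
direction as far as possible. -/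
theorem norm_torusCoeff_le {s σ ε : ℝ} (hσ : 0 < σ) {f : (Fin n → ℂ) → ℂ}
    (hf : DifferentiableOn ℂ f (strip n s))
    (hper : ∀ z ∈ strip n s, ∀ k : Fin n → ℤ, f (z + intVec k) = f z)
    (hε : ∀ z ∈ strip n s, ‖f z‖ ≤ ε) {w : Fin n → ℂ} (hw : w ∈ strip n (s - σ))
    (k : Fin n → ℤ) :
    ‖torusCoeff f w k‖ ≤ ε * Real.exp (-(2 * Real.pi * σ * ∑ j, |(k j : ℝ)|)) := by
  have hws : w ∈ strip n s := strip_mono (by linarith) hw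
  -- the shifted point, where the character is smallest
  set w' : Fin n → ℂ := fun j => w j - (σ * SignType.sign (k j : ℝ) : ℝ) * Complex.I with hw'
  have him : ∀ j, (w' j).im = (w j).im - σ * SignType.sign (k j : ℝ) := by
    intro j; simp [hw']
  have hw's : w' ∈ strip n s := by
    refine add_mem_strip hw ?_
    refine (pi_norm_le_iff_of_nonneg hσ.le).2 fun j => ?_
    simp only [hw', Pi.sub_apply, sub_sub_cancel_left, norm_neg, norm_mul, Complex.norm_I, mul_one,
      Complex.norm_real, Real.norm_eq_abs, abs_of_pos hσ]
    refine mul_le_of_le_one_right hσ.le ?_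
    rcases lt_trichotomy (k j : ℝ) 0 with h | h | h
    · simp [sign_neg h]
    · simp [h]
    · simp [sign_pos h]
  have hchar : ∀ k : Fin n → ℤ, Differentiable ℂ (character k) := fun k => by
    unfold character; fun_prop
  have hHbound : ∀ z ∈ strip n s, ‖character (-k) z * f z‖ ≤
      Real.exp (2 * Real.pi * ∑ j, |(k j : ℝ)| * s) * ε := by
    intro z hz
    rw [norm_mul, norm_character]
    refine mul_le_mul ?_ (hε z hz) (norm_nonneg _) (Real.exp_nonneg _)
    rw [Real.exp_le_exp, ← mul_neg, ← Finset.sum_neg_distrib]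
    gcongr with j
    simp only [Pi.neg_apply, Int.cast_neg, neg_mul, neg_neg]
    refine (le_abs_self _).trans ?_
    rw [abs_mul]
    exact mul_le_mul_of_nonneg_left (hz j).le (abs_nonneg _)
  have hperH : ∀ z ∈ strip n s, ∀ l : Fin n → ℤ,
      character (-k) (z + intVec l) * f (z + intVec l) = character (-k) z * f z := by
    intro z hz l
    rw [hper z hz, character_add, character_intVec, mul_one]
  rw [torusCoeff_eq hper hws, torusAverage_eq (H := fun z => character (-k) z * f z)
    ((hchar (-k)).differentiableOn.mul hf) hperH hHbound hws hw's, norm_mul, norm_character]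
  have hsum : ∑ j, (k j : ℝ) * (w' j).im = ∑ j, (k j : ℝ) * (w j).im - σ * ∑ j, |(k j : ℝ)| := by
    rw [Finset.mul_sum, ← Finset.sum_sub_distrib]
    refine Finset.sum_congr rfl fun j _ => ?_
    rw [him, ← sign_mul_self (k j : ℝ)]
    ring
  have hI : ‖∫ θ, torusLift (fun x => (fun z => character (-k) z * f z) (realVec x + w')) θ
      ∂torusMeasure n‖ ≤ Real.exp (2 * Real.pi * ∑ j, (k j : ℝ) * (w' j).im) * ε := by
    refine (norm_integral_le_of_norm_le_const
      (C := Real.exp (2 * Real.pi * ∑ j, (k j : ℝ) * (w' j).im) * ε)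
      (Eventually.of_forall fun θ => ?_)).trans (by simp)
    simp only [torusLift]
    rw [norm_mul, norm_character]
    refine mul_le_mul (le_of_eq ?_) (hε _ ?_) (norm_nonneg _) (Real.exp_nonneg _)
    · congr 1
      simp [realVec]
    · rw [add_comm]; exact (add_realVec_mem_strip _).2 hw's
  refine (mul_le_mul_of_nonneg_left hI (Real.exp_nonneg _)).trans (le_of_eq ?_)
  rw [hsum, ← mul_assoc, ← Real.exp_add, mul_comm ε]
  congr 2
  ring

/-- If `f` is invariant under the translations by the multiples of `v`, its Fourier coefficients
outside of the resonances `k · v = 0` vanish. -/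
theorem torusCoeff_eq_zero {s : ℝ} {f : (Fin n → ℂ) → ℂ}
    (hper : ∀ z ∈ strip n s, ∀ k : Fin n → ℤ, f (z + intVec k) = f z) {v : Fin n → ℝ}
    (hinv : ∀ z ∈ strip n s, ∀ t : ℝ, f (z + realVec (t • v)) = f z) {w : Fin n → ℂ}
    (hw : w ∈ strip n s) {k : Fin n → ℤ} (hk : ∑ j, (k j : ℝ) * v j ≠ 0) :
    torusCoeff f w k = 0 := by
  have hmem : ∀ x : Fin n → ℝ, realVec x + w ∈ strip n s := fun x => by
    rw [add_comm]; exact (add_realVec_mem_strip x).2 hw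
  -- translating by `t v` multiplies the coefficient by `-1`
  set t : ℝ := (2 * ∑ j, (k j : ℝ) * v j)⁻¹ with ht
  have h1 : torusCoeff f (w + realVec (t • v)) k = torusCoeff f w k := by
    unfold torusCoeff
    congr 1
    funext θ
    simp only [torusLift]
    rw [← add_assoc, hinv _ (hmem _)]
  have hchar : character k (realVec (t • v)) = -1 := by
    rw [character, ← Complex.exp_pi_mul_I]
    congr 1
    have h2 : ∑ j, (k j : ℂ) * realVec (t • v) j = ((t * ∑ j, (k j : ℝ) * v j : ℝ) : ℂ) := by
      simp only [realVec, Pi.smul_apply, smul_eq_mul, Finset.mul_sum]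
      push_cast
      exact Finset.sum_congr rfl fun j _ => by ring
    have h3 : t * ∑ j, (k j : ℝ) * v j = 1 / 2 := by rw [ht]; field_simp
    rw [h2, h3]
    push_cast
    ring
  have hw2 : w + realVec (t • v) ∈ strip n s := (add_realVec_mem_strip _).2 hw
  have hperH : ∀ x, ∀ l : Fin n → ℤ,
      (fun x => character (-k) (realVec x + w) * f (realVec x + w)) (x + fun j => (l j : ℝ)) =
      (fun x => character (-k) (realVec x + w) * f (realVec x + w)) x := by
    intro x l
    simp only [realVec_add, realVec_intCast]
    rw [add_right_comm, hper _ (hmem x), character_add _ _ (intVec l), character_intVec, mul_one]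
  have hint := integral_torusLift_add
    (g := fun x => character (-k) (realVec x + w) * f (realVec x + w)) hperH (t • v)
  have h2 : torusCoeff f (w + realVec (t • v)) k = -torusCoeff f w k := by
    rw [torusCoeff_eq hper hw2, torusCoeff_eq hper hw, character_add, hchar, mul_neg_one, neg_mul]
    congr 2
    rw [← hint]
    congr 1
    funext θ
    simp only [torusLift, realVec_add]
    congr 2 <;> abel_nf
  have h3 := h1.symm.trans h2
  exact self_eq_neg.1 h3

theorem sum_exp_neg_abs_le {σ : ℝ} (hσ : 0 < σ) (hσ1 : σ ≤ 1) (S : Finset ℤ) :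
    ∑ j ∈ S, Real.exp (-(σ * |(j : ℝ)|)) ≤ 4 / σ := by
  set r := Real.exp (-σ) with hr
  have hr0 : 0 ≤ r := (Real.exp_pos _).le
  have hr1 : r < 1 := by rw [hr, Real.exp_lt_one_iff]; linarith
  have h1 : HasSum (fun j : ℕ => Real.exp (-(σ * |((j : ℤ) : ℝ)|))) (1 - r)⁻¹ := by
    refine (hasSum_geometric_of_lt_one hr0 hr1).congr_fun fun j => ?_
    rw [hr, ← Real.exp_nat_mul]
    simp; ring
  have h2 : HasSum (fun j : ℕ => Real.exp (-(σ * |((-((j : ℤ) + 1) : ℤ) : ℝ)|)))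
      (r * (1 - r)⁻¹) := by
    refine ((hasSum_geometric_of_lt_one hr0 hr1).mul_left r).congr_fun fun j => ?_
    rw [hr, ← Real.exp_nat_mul, ← Real.exp_add]
    have : |((-((j : ℤ) + 1) : ℤ) : ℝ)| = (j : ℝ) + 1 := by
      push_cast; rw [abs_neg, abs_of_nonneg (by positivity)]
    rw [this]
    congr 1; ring
  have h3 := HasSum.of_nat_of_neg_add_one (f := fun j : ℤ => Real.exp (-(σ * |(j : ℝ)|))) h1 h2
  refine (sum_le_hasSum S (fun _ _ => Real.exp_nonneg _) h3).trans ?_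
  have h4 : σ / 2 ≤ 1 - r := by
    have h5 : r ≤ (1 + σ)⁻¹ := by
      rw [hr, Real.exp_neg]
      gcongr
      rw [add_comm]; exact Real.add_one_le_exp σ
    have h6 : (1 + σ)⁻¹ ≤ 1 - σ / 2 := by
      rw [inv_le_iff_one_le_mul₀ (by positivity)]
      nlinarith
    linarith
  have h7 : 0 < 1 - r := by linarith
  calc (1 - r)⁻¹ + r * (1 - r)⁻¹ = (1 + r) / (1 - r) := by field_simp
    _ ≤ 2 / (σ / 2) := by gcongr; linarith
    _ = 4 / σ := by ring

theorem sum_exp_neg_sum_abs_le {σ : ℝ} (hσ : 0 < σ) (hσ1 : σ ≤ 1) (S : Finset (Fin n → ℤ)) :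
    ∑ k ∈ S, Real.exp (-(σ * ∑ j, |(k j : ℝ)|)) ≤ (4 / σ) ^ n := by
  have hterm : ∀ k : Fin n → ℤ, Real.exp (-(σ * ∑ j, |(k j : ℝ)|)) =
      ∏ j, Real.exp (-(σ * |(k j : ℝ)|)) := fun k => by
    rw [← Real.exp_sum, Finset.sum_neg_distrib, Finset.mul_sum]
  have hS : S ⊆ Fintype.piFinset fun j => S.image fun k => k j := fun k hk => by
    rw [Fintype.mem_piFinset]
    exact fun j => Finset.mem_image_of_mem _ hk
  calc ∑ k ∈ S, Real.exp (-(σ * ∑ j, |(k j : ℝ)|))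
      ≤ ∑ k ∈ Fintype.piFinset (fun j : Fin n => S.image fun k : Fin n → ℤ => k j),
          Real.exp (-(σ * ∑ j, |(k j : ℝ)|)) :=
        Finset.sum_le_sum_of_subset_of_nonneg hS fun _ _ _ => Real.exp_nonneg _
    _ = ∏ j, ∑ i ∈ S.image (fun k : Fin n → ℤ => k j), Real.exp (-(σ * |(i : ℝ)|)) := by
        rw [Finset.prod_univ_sum]
        exact Finset.sum_congr rfl fun k _ => hterm k
    _ ≤ ∏ _j : Fin n, 4 / σ := Finset.prod_le_prod
        (fun _ _ => Finset.sum_nonneg fun _ _ => Real.exp_nonneg _)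
        fun _ _ => sum_exp_neg_abs_le hσ hσ1 _
    _ = (4 / σ) ^ n := by rw [Finset.prod_const, Finset.card_univ, Fintype.card_fin]

/-- A function without Fourier coefficients of orders `0 < |k| < K` is exponentially close to its
mean value on a smaller strip. -/
theorem norm_sub_torusCoeff_zero_le {s σ ε K : ℝ} (hσ : 0 < σ) (hσ1 : σ ≤ 1)
    {f : (Fin n → ℂ) → ℂ} (hf : DifferentiableOn ℂ f (strip n s))
    (hper : ∀ z ∈ strip n s, ∀ k : Fin n → ℤ, f (z + intVec k) = f z)
    (hε : ∀ z ∈ strip n s, ‖f z‖ ≤ ε) {w : Fin n → ℂ} (hw : w ∈ strip n (s - σ))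
    (hK : ∀ k : Fin n → ℤ, k ≠ 0 → ‖k‖ < K → torusCoeff f w k = 0) :
    ‖f w - torusCoeff f w 0‖ ≤ ε * Real.exp (-(σ * K)) * (4 / σ) ^ n := by
  have hws : w ∈ strip n s := strip_mono (by linarith) hw
  have hε0 : 0 ≤ ε := (norm_nonneg _).trans (hε w hws)
  have hmem : ∀ x : Fin n → ℝ, realVec x + w ∈ strip n s := fun x => by
    rw [add_comm]; exact (add_realVec_mem_strip x).2 hws
  have hperx : ∀ x, ∀ l : Fin n → ℤ, (fun x => f (realVec x + w)) (x + fun j => (l j : ℝ)) =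
      (fun x => f (realVec x + w)) x := by
    intro x l
    simp only [realVec_add, realVec_intCast]
    rw [add_right_comm, hper _ (hmem x)]
  have hcont : Continuous (torusLift fun x => f (realVec x + w)) :=
    continuous_torusLift (hf.continuousOn.comp_continuous
      (continuous_realVec.add continuous_const) hmem) hperx
  set u : (Fin n → ℤ) → ℝ := fun k => Real.exp (-(σ * ∑ j, |(k j : ℝ)|)) with hu
  have hpi : (2 : ℝ) ≤ 2 * Real.pi := by linarith [Real.pi_gt_three]
  have husum : Summable u := summable_of_sum_le (fun _ => Real.exp_nonneg _)
    (sum_exp_neg_sum_abs_le hσ hσ1)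
  have hutsum : ∑' k, u k ≤ (4 / σ) ^ n :=
    husum.tsum_le_of_sum_le (sum_exp_neg_sum_abs_le hσ hσ1)
  have habs : ∀ k : Fin n → ℤ, ‖k‖ ≤ ∑ j, |(k j : ℝ)| := fun k =>
    (pi_norm_le_iff_of_nonneg (Finset.sum_nonneg fun _ _ => abs_nonneg _)).2 fun j =>
      (Int.norm_eq_abs (k j)).le.trans
        (Finset.single_le_sum (f := fun j => |(k j : ℝ)|) (fun _ _ => abs_nonneg _)
          (Finset.mem_univ j))
  have hcoeff : ∀ k, ‖torusCoeff f w k‖ ≤ ε * u k := fun k => by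
    refine (norm_torusCoeff_le hσ hf hper hε hw k).trans ?_
    have h0 : 0 ≤ σ * ∑ j, |(k j : ℝ)| := by positivity
    refine mul_le_mul_of_nonneg_left (Real.exp_le_exp.2 ?_) hε0
    nlinarith
  have hcoeffK : ∀ k, k ≠ 0 → ‖torusCoeff f w k‖ ≤ ε * Real.exp (-(σ * K)) * u k := by
    intro k hk
    rcases lt_or_ge ‖k‖ K with h | h
    · rw [hK k hk h, norm_zero]; positivity
    · refine (norm_torusCoeff_le hσ hf hper hε hw k).trans ?_
      simp only [hu]
      rw [mul_assoc ε, ← Real.exp_add]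
      have h0 : 0 ≤ σ * ∑ j, |(k j : ℝ)| := by positivity
      have h1 : σ * K ≤ σ * ∑ j, |(k j : ℝ)| := by gcongr; exact h.trans (habs k)
      refine mul_le_mul_of_nonneg_left (Real.exp_le_exp.2 ?_) hε0
      nlinarith
  have hsum : HasSum (fun k => torusCoeff f w k) (f w) := by
    have h := UnitAddTorus.hasSum_mFourier_series_apply_of_summable
      (f := ⟨torusLift fun x => f (realVec x + w), hcont⟩)
      (Summable.of_norm_bounded (husum.mul_left ε) hcoeff) (toTorus 0)
    have h0 : realVec (0 : Fin n → ℝ) = 0 := by funext j; simp [realVec]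
    simp only [mFourier_toTorus, ContinuousMap.coe_mk, h0,
      torusLift_toTorus (g := fun x => f (realVec x + w)) hperx, zero_add] at h
    have hc0 : ∀ k : Fin n → ℤ, character k 0 = 1 := fun k => by simp [character]
    simp only [hc0, smul_eq_mul, mul_one] at h
    exact h
  have hdiff := hsum.sub (hasSum_ite_eq (0 : Fin n → ℤ) (torusCoeff f w 0))
  have hbound : HasSum (fun k => ε * Real.exp (-(σ * K)) * u k)
      (ε * Real.exp (-(σ * K)) * ∑' k, u k) := husum.hasSum.mul_left _
  calc ‖f w - torusCoeff f w 0‖ ≤ ε * Real.exp (-(σ * K)) * ∑' k, u k := by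
        refine hdiff.tsum_eq ▸ tsum_of_norm_bounded hbound fun k => ?_
        by_cases hk : k = 0
        · subst hk; simp only [if_true, sub_self, norm_zero]; positivity
        · simp only [hk, if_false, sub_zero]; exact hcoeffK k hk
    _ ≤ _ := by gcongr

end Decay

/-! ### Averages along periodic flows -/

section Averaging

variable {n : ℕ}

theorem constFlow_mem_strip {s : ℝ} {v : Fin n → ℝ} {t : ℝ} {z : Fin n → ℂ} :
    constFlow v t z ∈ strip n s ↔ z ∈ strip n s := add_realVec_mem_strip _

theorem continuous_constFlow (v : Fin n → ℝ) :
    Continuous fun x : ℝ × (Fin n → ℂ) => constFlow v x.1 x.2 := by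
  unfold constFlow realVec
  fun_prop

theorem constFlow_add (v : Fin n → ℝ) (r t : ℝ) (z : Fin n → ℂ) :
    constFlow v t (constFlow v r z) = constFlow v (r + t) z := by
  simp only [constFlow, add_assoc, ← realVec_add, ← add_smul]

/-- The weighted average of `P` along the constant flow in the direction `v`. -/
noncomputable def weightedAverage (φ : ℝ → ℝ) (v : Fin n → ℝ) (P : (Fin n → ℂ) → (Fin n → ℂ))
    (z : Fin n → ℂ) : Fin n → ℂ :=
  ∫ t in (0 : ℝ)..1, φ t • P (constFlow v t z)

variable {φ : ℝ → ℝ} {v : Fin n → ℝ} {P : (Fin n → ℂ) → (Fin n → ℂ)} {s : ℝ}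

theorem continuous_comp_constFlow (hP : ContinuousOn P (strip n s)) {z : Fin n → ℂ}
    (hz : z ∈ strip n s) : Continuous fun t => P (constFlow v t z) :=
  hP.comp_continuous ((continuous_constFlow v).comp (by fun_prop : Continuous fun t : ℝ => (t, z)))
    fun _ => constFlow_mem_strip.2 hz

theorem hasFDerivAt_weightedAverage (hφ : Continuous φ) {ε : ℝ}
    (hP : DifferentiableOn ℂ P (strip n s)) (hε : NormLE s P ε) {z : Fin n → ℂ}
    (hz : z ∈ strip n s) :
    IntervalIntegrable (fun t => φ t • fderiv ℂ P (constFlow v t z)) volume 0 1 ∧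
      HasFDerivAt (weightedAverage φ v P)
        (∫ t in (0 : ℝ)..1, φ t • fderiv ℂ P (constFlow v t z)) z := by
  obtain ⟨ρ, hρ, hball⟩ := Metric.isOpen_iff.1 (isOpen_strip s) z hz
  obtain ⟨B, hB⟩ := (isCompact_Icc (a := (0 : ℝ)) (b := 1)).exists_bound_of_continuousOn
    hφ.continuousOn
  have hdiff : ∀ t, ∀ u ∈ strip n s, HasFDerivAt (fun w => φ t • P (constFlow v t w))
      (φ t • fderiv ℂ P (constFlow v t u)) u := by
    intro t u hu
    have hu' : constFlow v t u ∈ strip n s := constFlow_mem_strip.2 hu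
    have h1 := ((hP _ hu').differentiableAt ((isOpen_strip s).mem_nhds hu')).hasFDerivAt
    have h2 : HasFDerivAt (constFlow v t) (ContinuousLinearMap.id ℂ (Fin n → ℂ)) u :=
      (hasFDerivAt_id u).add_const _
    have h3 := (h1.comp u h2).const_smul (φ t)
    rwa [ContinuousLinearMap.comp_id] at h3
  have hB0 : 0 ≤ B := (norm_nonneg _).trans (hB 0 (left_mem_Icc.2 zero_le_one))
  have h := hasFDerivAt_integral_of_ball (μ := volume.restrict (Ioc (0 : ℝ) 1))
    (f := fun w t => φ t • P (constFlow v t w)) (z := z) (M := B * ε) hρ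
    (fun u hu => (hφ.smul (continuous_comp_constFlow hP.continuousOn
      (hball hu))).aestronglyMeasurable)
    (Eventually.of_forall fun t u hu =>
      (hdiff t u (hball hu)).differentiableAt.differentiableWithinAt)
    ((ae_restrict_iff' measurableSet_Ioc).2 (Eventually.of_forall fun t ht u hu => by
      rw [norm_smul]
      exact mul_le_mul (hB t (Ioc_subset_Icc_self ht)) (hε _ (constFlow_mem_strip.2 (hball hu)))
        (norm_nonneg _) hB0))
  simp only [(hdiff _ z hz).fderiv] at h
  constructor
  · rw [intervalIntegrable_iff_integrableOn_Ioc_of_le zero_le_one]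
    exact h.1
  · rw [intervalIntegral.integral_of_le zero_le_one]
    have heq : weightedAverage φ v P =
        fun w => ∫ t in Ioc (0 : ℝ) 1, φ t • P (constFlow v t w) := by
      funext w
      rw [weightedAverage, intervalIntegral.integral_of_le zero_le_one]
    rw [heq]
    exact h.2

theorem differentiableOn_weightedAverage (hφ : Continuous φ) {ε : ℝ}
    (hP : DifferentiableOn ℂ P (strip n s)) (hε : NormLE s P ε) :
    DifferentiableOn ℂ (weightedAverage φ v P) (strip n s) := fun _ hz =>
  (hasFDerivAt_weightedAverage hφ hP hε hz).2.differentiableAt.differentiableWithinAt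

theorem periodicAverage_eq (q : ℕ) (ω : Fin n → ℝ) (P : (Fin n → ℂ) → (Fin n → ℂ)) :
    periodicAverage q ω P = weightedAverage (fun _ => 1) ((q : ℝ) • ω) P := by
  funext z
  simp [periodicAverage, weightedAverage]

theorem IsAnalyticField.comp_constFlow_add_one (hP : IsAnalyticField s P) {l : Fin n → ℤ}
    (hv : v = fun j => (l j : ℝ)) {z : Fin n → ℂ} (hz : z ∈ strip n s) (t : ℝ) :
    P (constFlow v (t + 1) z) = P (constFlow v t z) := by
  have : constFlow v (t + 1) z = constFlow v t z + intVec l := by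
    rw [← constFlow_add, constFlow, one_smul, hv, realVec_intCast]
  rw [this]
  exact hP.periodic _ (constFlow_mem_strip.2 hz) l

/-- The average along a periodic flow is invariant under the flow. -/
theorem weightedAverage_one_constFlow (hP : IsAnalyticField s P) {l : Fin n → ℤ}
    (hv : v = fun j => (l j : ℝ)) {z : Fin n → ℂ} (hz : z ∈ strip n s) (r : ℝ) :
    weightedAverage (fun _ => 1) v P (constFlow v r z) = weightedAverage (fun _ => 1) v P z := by
  have hper : Function.Periodic (fun t => P (constFlow v t z)) 1 := fun t =>
    hP.comp_constFlow_add_one hv hz t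
  have h := hper.intervalIntegral_add_eq r 0
  simp only [weightedAverage, one_smul, constFlow_add]
  rw [intervalIntegral.integral_comp_add_left (fun t => P (constFlow v t z))]
  simpa using h

theorem weightedAverage_periodic (hP : IsAnalyticField s P) {z : Fin n → ℂ}
    (hz : z ∈ strip n s) (k : Fin n → ℤ) :
    weightedAverage φ v P (z + intVec k) = weightedAverage φ v P z := by
  simp only [weightedAverage]
  congr 1
  funext t
  have : constFlow v t (z + intVec k) = constFlow v t z + intVec k := by
    simp only [constFlow, add_right_comm]
  rw [this, hP.periodic _ (constFlow_mem_strip.2 hz)]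

theorem intervalIntegral_apply {f : ℝ → Fin n → ℂ} (hf : IntervalIntegrable f volume 0 1)
    (j : Fin n) : (∫ t in (0 : ℝ)..1, f t) j = ∫ t in (0 : ℝ)..1, f t j :=
  ((ContinuousLinearMap.proj (R := ℝ) (φ := fun _ : Fin n => ℂ) j).intervalIntegral_comp_comm
    hf).symm

theorem weightedAverage_real (hφ : Continuous φ) (hP : ContinuousOn P (strip n s)) (hs : 0 < s)
    (hre : RealOnReals P) : RealOnReals (weightedAverage φ v P) := by
  intro x j
  have hc : Continuous fun t => φ t • P (constFlow v t (realVec x)) :=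
    hφ.smul (continuous_comp_constFlow hP (realVec_mem_strip hs x))
  have h := Complex.imCLM.intervalIntegral_comp_comm
    (((continuous_apply j).comp hc).intervalIntegrable (μ := volume) 0 1)
  rw [weightedAverage, intervalIntegral_apply (hc.intervalIntegrable 0 1)]
  refine h.symm.trans ?_
  have h0 : ∀ t, Complex.imCLM (((fun p => p j) ∘ fun t => φ t • P (constFlow v t (realVec x))) t)
      = 0 := by
    intro t
    have := hre (x + t • v) j
    rw [realVec_add] at this
    simp [constFlow, this]
  simp only [h0, intervalIntegral.integral_zero]

theorem norm_weightedAverage_one_le {ε : ℝ} (hε : NormLE s P ε) {z : Fin n → ℂ}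
    (hz : z ∈ strip n s) : ‖weightedAverage (fun _ => 1) v P z‖ ≤ ε := by
  have := intervalIntegral.norm_integral_le_of_norm_le_const (a := (0 : ℝ)) (b := 1) (C := ε)
    (f := fun t => (1 : ℝ) • P (constFlow v t z))
    (fun t _ => by rw [one_smul]; exact hε _ (constFlow_mem_strip.2 hz))
  simpa [weightedAverage] using this

/-- Along a periodic flow, the averaging field is a weighted average with weight of mean zero. -/
theorem averagingField_eq (hP : IsAnalyticField s P) {q : ℕ} {ω : Fin n → ℝ} {l : Fin n → ℤ}
    (hv : (q : ℝ) • ω = fun j => (l j : ℝ)) {z : Fin n → ℂ} (hz : z ∈ strip n s) :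
    averagingField q ω P z = weightedAverage (fun t => q * (t - 1 / 2)) ((q : ℝ) • ω) P z := by
  have hc : Continuous fun t => P (constFlow ((q : ℝ) • ω) t z) :=
    continuous_comp_constFlow hP.holomorphic.continuousOn hz
  set G := weightedAverage (fun _ => 1) ((q : ℝ) • ω) P z with hG
  have hG' : G = ∫ t in (0 : ℝ)..1, P (constFlow ((q : ℝ) • ω) t z) := by
    simp [hG, weightedAverage]
  have h1 : ∀ t, periodicAverage q ω P (constFlow ((q : ℝ) • ω) t z) = G := fun t => by
    rw [periodicAverage_eq, weightedAverage_one_constFlow hP hv hz]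
  simp only [averagingField, h1]
  rw [weightedAverage, ← intervalIntegral.integral_smul]
  have hi1 : IntervalIntegrable (fun t => (q * t) • P (constFlow ((q : ℝ) • ω) t z)) volume 0 1 :=
    ((by fun_prop : Continuous fun t : ℝ => (q : ℝ) * t).smul hc).intervalIntegrable _ _
  have hi2 : IntervalIntegrable (fun t : ℝ => ((q : ℝ) * t) • G) volume 0 1 :=
    Continuous.intervalIntegrable (by fun_prop) _ _
  have hi3 : IntervalIntegrable (fun t => ((q : ℝ) / 2) • P (constFlow ((q : ℝ) • ω) t z))
      volume 0 1 := (hc.const_smul ((q : ℝ) / 2)).intervalIntegrable _ _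
  have e1 : ∀ t : ℝ, (q : ℝ) • t • (P (constFlow ((q : ℝ) • ω) t z) - G) =
      (q * t) • P (constFlow ((q : ℝ) • ω) t z) - ((q : ℝ) * t) • G := fun t => by
    rw [smul_smul, smul_sub]
  have e2 : ∀ t : ℝ, (q * (t - 1 / 2)) • P (constFlow ((q : ℝ) • ω) t z) =
      (q * t) • P (constFlow ((q : ℝ) • ω) t z) -
        ((q : ℝ) / 2) • P (constFlow ((q : ℝ) • ω) t z) := fun t => by
    rw [← sub_smul]; congr 1; ring
  simp only [e1, e2]
  rw [intervalIntegral.integral_sub hi1 hi2, intervalIntegral.integral_sub hi1 hi3,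
    intervalIntegral.integral_smul, ← hG', intervalIntegral.integral_smul_const]
  congr 2
  rw [intervalIntegral.integral_const_mul, integral_id]
  ring

theorem norm_averagingField_le {q : ℕ} {ω : Fin n → ℝ} {ε : ℝ} (hε : NormLE s P ε)
    {z : Fin n → ℂ} (hz : z ∈ strip n s) :
    ‖averagingField q ω P z‖ ≤ q * ε := by
  rw [averagingField, norm_smul, Real.norm_natCast]
  gcongr
  have hb : ∀ t ∈ Ioc (0 : ℝ) 1, ‖t • (P (constFlow ((q : ℝ) • ω) t z) -
      periodicAverage q ω P (constFlow ((q : ℝ) • ω) t z))‖ ≤ t * (2 * ε) := by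
    intro t ht
    have hz' : constFlow ((q : ℝ) • ω) t z ∈ strip n s := constFlow_mem_strip.2 hz
    rw [norm_smul, Real.norm_of_nonneg ht.1.le]
    refine mul_le_mul_of_nonneg_left ?_ ht.1.le
    rw [periodicAverage_eq]
    have := norm_sub_le (P (constFlow ((q : ℝ) • ω) t z))
      (weightedAverage (fun _ => 1) ((q : ℝ) • ω) P (constFlow ((q : ℝ) • ω) t z))
    linarith [hε _ hz', norm_weightedAverage_one_le (v := (q : ℝ) • ω) hε hz']
  refine (intervalIntegral.norm_integral_le_of_norm_le zero_le_one
    (g := fun t => t * (2 * ε)) (Eventually.of_forall hb)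
    (Continuous.intervalIntegrable (by fun_prop) _ _)).trans (le_of_eq ?_)
  rw [intervalIntegral.integral_mul_const, integral_id]
  ring

/-- The averaging field solves the homological equation `DV · (qω) = q (P - [P]_ω)`. -/
theorem fderiv_weightedAverage_apply (hP : IsAnalyticField s P) {ε : ℝ} (hε : NormLE s P ε)
    (c : ℝ) {l : Fin n → ℤ} (hv : v = fun j => (l j : ℝ)) {z : Fin n → ℂ} (hz : z ∈ strip n s) :
    fderiv ℂ (weightedAverage (fun t => c * (t - 1 / 2)) v P) z (realVec v) =
      c • (P z - weightedAverage (fun _ => 1) v P z) := by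
  obtain ⟨hint, hd⟩ := hasFDerivAt_weightedAverage (v := v) (z := z)
    (φ := fun t => c * (t - 1 / 2)) (by fun_prop) hP.holomorphic hε hz
  rw [hd.fderiv]
  have hmem : ∀ t, constFlow v t z ∈ strip n s := fun t => constFlow_mem_strip.2 hz
  have hcont : Continuous fun t => fderiv ℂ P (constFlow v t z) (realVec v) := by
    have h1 : Continuous fun t => fderiv ℂ P (constFlow v t z) :=
      (differentiableOn_fderiv (isOpen_strip s) hP.holomorphic).continuousOn.comp_continuous
        ((continuous_constFlow v).comp (by fun_prop : Continuous fun t : ℝ => (t, z))) hmem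
    fun_prop
  have happ : (∫ t in (0 : ℝ)..1, (c * (t - 1 / 2)) • fderiv ℂ P (constFlow v t z)) (realVec v) =
      ∫ t in (0 : ℝ)..1, (c * (t - 1 / 2)) • fderiv ℂ P (constFlow v t z) (realVec v) :=
    (((ContinuousLinearMap.apply ℂ (Fin n → ℂ) (realVec v)).restrictScalars
      ℝ).intervalIntegral_comp_comm hint).symm
  rw [happ]
  have hder : ∀ t : ℝ, HasDerivAt (fun t => P (constFlow v t z))
      (fderiv ℂ P (constFlow v t z) (realVec v)) t := by
    intro t
    have h1 := ((hP.holomorphic _ (hmem t)).differentiableAt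
      ((isOpen_strip s).mem_nhds (hmem t))).hasFDerivAt.restrictScalars ℝ
    have h2 : HasDerivAt (fun t => constFlow v t z) (realVec v) t := by
      have h3 : (fun t : ℝ => constFlow v t z) = fun t => z + t • realVec v := by
        funext t; rw [constFlow, realVec_smul]; rfl
      rw [h3]
      simpa using ((hasDerivAt_id t).smul_const (realVec v)).const_add z
    exact h1.comp_hasDerivAt t h2
  have hφ : ∀ t : ℝ, HasDerivAt (fun t => c * (t - 1 / 2)) c t := fun t => by
    simpa only [mul_one, id] using ((hasDerivAt_id t).sub_const (1 / 2)).const_mul c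
  have hparts := intervalIntegral.integral_smul_deriv_eq_deriv_smul (a := 0) (b := 1)
    (u := fun t => c * (t - 1 / 2)) (u' := fun _ => c) (fun t _ => hφ t) (fun t _ => hder t)
    (by simp) (hcont.intervalIntegrable _ _)
  rw [hparts, intervalIntegral.integral_smul]
  have h1 : P (constFlow v 1 z) = P z := by
    have := hP.comp_constFlow_add_one hv hz 0
    rw [zero_add] at this
    rw [this, constFlow]
    congr 1; funext j; simp [realVec]
  have h0 : P (constFlow v 0 z) = P z := by
    rw [constFlow]
    congr 1; funext j; simp [realVec]
  have hG : weightedAverage (fun _ => 1) v P z = ∫ t in (0 : ℝ)..1, P (constFlow v t z) := by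
    simp [weightedAverage]
  rw [h1, h0, hG, smul_sub, ← sub_smul]
  congr 2
  ring

/-- The mean value over the torus is not changed by averaging along a flow. -/
theorem integral_torusLift_weightedAverage (hP : IsAnalyticField s P) {ε : ℝ} (hs : 0 < s)
    (hε : NormLE s P ε) :
    ∫ θ, torusLift (fun x => weightedAverage (fun _ => 1) v P (realVec x)) θ ∂torusMeasure n =
      spaceAverage P := by
  have hper : ∀ x, ∀ k : Fin n → ℤ, (fun x => P (realVec x)) (x + fun j => (k j : ℝ)) =
      (fun x => P (realVec x)) x := by
    intro x k
    simp only [realVec_add, realVec_intCast]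
    exact hP.periodic _ (realVec_mem_strip hs x) k
  have hcont : Continuous fun x : Fin n → ℝ => P (realVec x) :=
    hP.holomorphic.continuousOn.comp_continuous continuous_realVec (realVec_mem_strip hs)
  set g := torusLift fun x => P (realVec x) with hg
  have hgc : Continuous g := continuous_torusLift hcont hper
  have hgb : ∀ θ, ‖g θ‖ ≤ ε := fun θ => hε _ (realVec_mem_strip hs _)
  have htt : Continuous fun t : ℝ => toTorus (t • v) := by
    refine isOpenQuotientMap_toTorus.continuous.comp ?_
    fun_prop
  have hlift : ∀ θ, torusLift (fun x => weightedAverage (fun _ => 1) v P (realVec x)) θ =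
      ∫ t in (0 : ℝ)..1, g (θ + toTorus (t • v)) := by
    intro θ
    simp only [torusLift, weightedAverage, one_smul]
    congr 1
    funext t
    rw [hg, torusLift_add_toTorus (g := fun x => P (realVec x)) hper]
    simp only [torusLift, constFlow, realVec_add]
  simp only [hlift, intervalIntegral.integral_of_le zero_le_one]
  rw [integral_integral_swap]
  · have : ∀ t : ℝ, ∫ θ, g (θ + toTorus (t • v)) ∂torusMeasure n = spaceAverage P := fun t => by
      rw [integral_add_right_eq_self g, hg,
        integral_torusLift (g := fun x => P (realVec x)) hper, spaceAverage]
    simp [this]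
  · refine Integrable.of_bound (C := ε) (Continuous.aestronglyMeasurable ?_)
      (Eventually.of_forall fun x => hgb _)
    exact hgc.comp (continuous_fst.add (htt.comp continuous_snd))

/-- The average along the flow and the mean value differ by the contribution of the resonances,
which is exponentially small if these are of order at least `K`. -/
theorem norm_weightedAverage_sub_spaceAverage_le (hP : IsAnalyticField s P) {ε σ K : ℝ}
    (hσ : 0 < σ) (hσ1 : σ ≤ 1) (hε : NormLE s P ε) {l : Fin n → ℤ} (hv : v = fun j => (l j : ℝ))
    (hK : ∀ k : Fin n → ℤ, k ≠ 0 → ∑ j, k j * l j = 0 → K ≤ ‖k‖) {z : Fin n → ℂ}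
    (hz : z ∈ strip n (s - σ)) :
    ‖weightedAverage (fun _ => 1) v P z - spaceAverage P‖ ≤
      ε * Real.exp (-(σ * K)) * (4 / σ) ^ n := by
  have hzs : z ∈ strip n s := strip_mono (by linarith) hz
  have hε0 : 0 ≤ ε := (norm_nonneg _).trans (hε z hzs)
  set G := weightedAverage (fun _ => 1) v P with hG
  have hGd : DifferentiableOn ℂ G (strip n s) :=
    differentiableOn_weightedAverage continuous_const hP.holomorphic hε
  refine (pi_norm_le_iff_of_nonneg (by positivity)).2 fun j => ?_
  have hs : 0 < s := (abs_nonneg _).trans_lt (hzs j)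
  have h0s : (0 : Fin n → ℂ) ∈ strip n s := fun j => by simpa using hs
  have hfd : DifferentiableOn ℂ (fun w => G w j) (strip n s) := fun w hw =>
    (differentiableWithinAt_pi.1 (hGd w hw)) j
  have hfper : ∀ w ∈ strip n s, ∀ k : Fin n → ℤ, G (w + intVec k) j = G w j := fun w hw k => by
    rw [hG, weightedAverage_periodic hP hw]
  have hfb : ∀ w ∈ strip n s, ‖G w j‖ ≤ ε := fun w hw =>
    (norm_le_pi_norm _ j).trans (norm_weightedAverage_one_le hε hw)
  have h := norm_sub_torusCoeff_zero_le (f := fun w => G w j) (K := K) hσ hσ1 hfd hfper hfb hz ?_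
  · suffices hcoeff : torusCoeff (fun w => G w j) z 0 = spaceAverage P j by
      rw [hcoeff] at h
      exact h
    have hchar : ∀ w : Fin n → ℂ, character 0 w = 1 := fun w => by simp [character]
    rw [torusCoeff_eq hfper hzs, hchar, one_mul]
    simp only [neg_zero, hchar, one_mul]
    rw [torusAverage_eq hfd hfper hfb hzs h0s]
    simp only [add_zero]
    rw [← integral_torusLift_weightedAverage (v := v) hP hs hε]
    have hint : Integrable (torusLift fun x => G (realVec x)) (torusMeasure n) := by
      refine Integrable.of_bound (C := ε) (Continuous.aestronglyMeasurable
        (continuous_torusLift ?_ ?_)) (Eventually.of_forall fun θ =>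
          norm_weightedAverage_one_le hε (realVec_mem_strip hs _))
      · exact hGd.continuousOn.comp_continuous continuous_realVec (realVec_mem_strip hs)
      · intro x k
        rw [realVec_add, realVec_intCast, hG, weightedAverage_periodic hP (realVec_mem_strip hs x)]
    exact (ContinuousLinearMap.proj (R := ℝ) (φ := fun _ : Fin n => ℂ) j).integral_comp_comm hint
  · intro k hk0 hkK
    refine torusCoeff_eq_zero (v := v) hfper ?_ hzs fun hkv => ?_
    · intro w hw t
      have := weightedAverage_one_constFlow hP hv hw t
      rw [constFlow] at this
      rw [hG, this]
    · refine absurd (hK k hk0 ?_) (not_le.2 hkK)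
      simp only [hv] at hkv
      exact_mod_cast hkv

theorem norm_spaceAverage_le {ε : ℝ} (hs : 0 < s) (hε : NormLE s P ε) : ‖spaceAverage P‖ ≤ ε := by
  have := norm_setIntegral_le_of_norm_le_const (μ := volume) (s := Icc (0 : Fin n → ℝ) 1) (C := ε)
    (f := fun x => P (realVec x)) (by rw [Real.volume_Icc_pi]; simp)
    fun x _ => hε _ (realVec_mem_strip hs x)
  simpa [spaceAverage, Measure.real, Real.volume_Icc_pi] using this

theorem im_spaceAverage (hs : 0 < s) (hP : ContinuousOn P (strip n s)) (hre : RealOnReals P)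
    (j : Fin n) : (spaceAverage P j).im = 0 := by
  have hc : Continuous fun x : Fin n → ℝ => P (realVec x) :=
    hP.comp_continuous continuous_realVec (realVec_mem_strip hs)
  have hi : IntegrableOn (fun x : Fin n → ℝ => P (realVec x)) (Icc 0 1) :=
    hc.continuousOn.integrableOn_compact isCompact_Icc
  have h := (Complex.imCLM.comp (ContinuousLinearMap.proj (R := ℝ) (φ := fun _ : Fin n => ℂ)
    j)).integral_comp_comm hi
  refine h.symm.trans ?_
  simp [hre _ j]

end Averaging

/-! ### Time-one maps on strips -/

section TimeOneMap

variable {n : ℕ}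

/-- A small holomorphic vector field on a strip has a holomorphic time-one map on a smaller strip,
together with its orbits `c` and the solutions `W` of the variational equation along them. -/
theorem exists_timeOne_map {s σ M : ℝ} {V : (Fin n → ℂ) → (Fin n → ℂ)} (hσ : 0 < σ)
    (hV : DifferentiableOn ℂ V (strip n s)) (hM0 : 0 ≤ M) (hM : NormLE s V M) (hMσ : 8 * M ≤ σ) :
    ∃ Φ : (Fin n → ℂ) → (Fin n → ℂ), ∀ z ∈ strip n (s - σ),
      (∃ (c : ℝ → Fin n → ℂ) (W : ℝ → (Fin n → ℂ) →L[ℂ] (Fin n → ℂ)), c 0 = z ∧ c 1 = Φ z ∧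
        (∀ t ∈ Icc (0 : ℝ) 1, c t ∈ strip n (s - 3 / 4 * σ) ∧ ‖c t - z‖ ≤ M ∧
          HasDerivWithinAt c (V (c t)) (Icc 0 1) t) ∧
        W 0 = ContinuousLinearMap.id ℂ (Fin n → ℂ) ∧
        (∀ t ∈ Icc (0 : ℝ) 1, HasDerivWithinAt W ((fderiv ℂ V (c t)).comp (W t)) (Icc 0 1) t) ∧
        ‖W 1 - ContinuousLinearMap.id ℂ (Fin n → ℂ)‖ ≤ 4 / 3 * (2 * M / σ) ∧
        HasFDerivAt Φ (W 1) z) ∧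
      ∀ c : ℝ → Fin n → ℂ, c 0 = z →
        (∀ t ∈ Icc (0 : ℝ) 1, c t ∈ strip n (s - 3 / 4 * σ) ∧
          HasDerivWithinAt c (V (c t)) (Icc 0 1) t) → c 1 = Φ z := by
  set D := strip n (s - 3 / 4 * σ) with hD
  set K := 2 * M / σ with hK
  have hK0 : 0 ≤ K := by positivity
  have hK4 : K ≤ 1 / 4 := by rw [hK, div_le_iff₀ hσ]; linarith
  have hDs : D ⊆ strip n s := strip_mono (by linarith)
  have hDs2 : D ⊆ strip n (s - σ / 2) := strip_mono (by linarith)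
  have hder : ∀ x ∈ D, HasFDerivAt V (fderiv ℂ V x) x := fun x hx =>
    ((hV x (hDs hx)).differentiableAt ((isOpen_strip s).mem_nhds (hDs hx))).hasFDerivAt
  have hVK' : ∀ x ∈ strip n (s - σ / 2), ‖fderiv ℂ V x‖ ≤ K := fun x hx =>
    (norm_fderiv_le_of_strip (by positivity) hV hM hx).trans (le_of_eq (by rw [hK]; field_simp))
  have hVK : ∀ x ∈ D, ‖fderiv ℂ V x‖ ≤ K := fun x hx => hVK' x (hDs2 hx)
  have hD' : D = strip n (s - σ / 2 - σ / 4) := by rw [hD]; congr 1; ring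
  have hdV := differentiableOn_fderiv (isOpen_strip s) hV
  have hV₂ : ∀ x ∈ D, ∀ y ∈ D,
      ‖fderiv ℂ V x - fderiv ℂ V y‖ ≤ K / (σ / 4) * ‖x - y‖ := by
    intro x hx y hy
    rw [hD'] at hx hy
    exact norm_sub_le_of_strip (by positivity) (hdV.mono (strip_mono (by linarith))) hVK' hy hx
  have hlip : ∀ x ∈ D, ∀ y ∈ D, ‖V x - V y‖ ≤ K * ‖x - y‖ := fun x hx y hy =>
    (convex_strip _).norm_image_sub_le_of_norm_hasFDerivWithin_le (𝕜 := ℂ)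
      (fun w hw => (hder w hw).hasFDerivWithinAt) hVK hy hx
  have hcball : ∀ z ∈ strip n (s - σ), closedBall z M ⊆ D := fun z hz w hw => by
    refine add_mem_strip (δ := σ / 4) (strip_mono (by linarith) hz) ?_
    exact (mem_closedBall_iff_norm.1 hw).trans (by linarith)
  have hex : ∀ z, ∃ c : ℝ → Fin n → ℂ, z ∈ strip n (s - σ) → c 0 = z ∧ ∀ t ∈ Icc (0 : ℝ) 1,
      c t ∈ closedBall z M ∧ HasDerivWithinAt c (V (c t)) (Icc 0 1) t := by
    intro z
    by_cases hz : z ∈ strip n (s - σ)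
    · have hb := hcball z hz
      obtain ⟨c, hc⟩ := exists_integralCurve_mem_closedBall (f := fun _ => V) (x₀ := z) hM0 hK0
        (fun t _ x hx y hy => hlip x (hb hx) y (hb hy)) (fun x _ => continuousOn_const)
        (fun t _ x hx => hM x (hDs (hb hx))) le_rfl
      exact ⟨c, fun _ => hc⟩
    · exact ⟨fun _ => 0, fun h => absurd h hz⟩
  choose c hc using hex
  have hcD : ∀ z ∈ strip n (s - σ), ∀ t ∈ Icc (0 : ℝ) 1,
      c z t ∈ D ∧ HasDerivWithinAt (c z) (V (c z t)) (Icc 0 1) t := fun z hz t ht =>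
    ⟨hcball z hz ((hc z hz).2 t ht).1, ((hc z hz).2 t ht).2⟩
  refine ⟨fun z => c z 1, fun z hz => ⟨?_, ?_⟩⟩
  · have hcc : ContinuousOn (c z) (Icc 0 1) := fun t ht => (hcD z hz t ht).2.continuousWithinAt
    obtain ⟨W, hW0, hW⟩ := exists_linear_flow (A := fun t => fderiv ℂ V (c z t)) hK0 hK4
      (hdV.continuousOn.comp hcc fun t ht => hDs (hcD z hz t ht).1)
      (fun t ht => hVK _ (hcD z hz t ht).1)
    refine ⟨c z, W, (hc z hz).1, rfl, fun t ht => ⟨(hcD z hz t ht).1, ?_, (hcD z hz t ht).2⟩, hW0,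
      fun t ht => (hW t ht).2, (hW 1 (right_mem_Icc.2 zero_le_one)).1, ?_⟩
    · exact mem_closedBall_iff_norm.1 ((hc z hz).2 t ht).1
    · refine hasFDerivAt_timeOne (convex_strip _) hK0 (by positivity : 0 ≤ K / (σ / 4)) hder hVK hV₂
        (φ := fun z => c z 1) (hc z hz).1 rfl (hcD z hz) ?_ hW0 fun t ht => (hW t ht).2
      filter_upwards [(isOpen_strip (s - σ)).mem_nhds hz] with w hw
      exact ⟨c w, (hc w hw).1, rfl, hcD w hw⟩
  · intro c' hc'0 hc'
    have hsub : Ico (0 : ℝ) 1 ⊆ Icc 0 1 := Ico_subset_Icc_self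
    have h := dist_le_of_trajectories_ODE_of_mem (v := fun _ => V) (s := fun _ => D)
      (K := K.toNNReal) (δ := 0) (f := c') (g := c z) (a := 0) (b := 1)
      (fun t _ => LipschitzOnWith.of_dist_le_mul fun x hx y hy => by
        rw [dist_eq_norm, dist_eq_norm, Real.coe_toNNReal _ hK0]; exact hlip x hx y hy)
      (fun t ht => (hc' t ht).2.continuousWithinAt)
      (fun t ht => hasDerivWithinAt_Ici_of_Icc ht (hc' t (hsub ht)).2)
      (fun t ht => (hc' t (hsub ht)).1)
      (fun t ht => (hcD z hz t ht).2.continuousWithinAt)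
      (fun t ht => hasDerivWithinAt_Ici_of_Icc ht (hcD z hz t (hsub ht)).2)
      (fun t ht => (hcD z hz t (hsub ht)).1) (by rw [hc'0, (hc z hz).1, dist_self]) 1
      (right_mem_Icc.2 zero_le_one)
    rw [zero_mul] at h
    exact dist_le_zero.1 h

theorem bijective_of_norm_sub_id_le {A : (Fin n → ℂ) →L[ℂ] (Fin n → ℂ)}
    (hA : ‖A - ContinuousLinearMap.id ℂ (Fin n → ℂ)‖ ≤ 1 / 3) : Function.Bijective A := by
  have hinj : Function.Injective A.toLinearMap := by
    rw [← LinearMap.ker_eq_bot, LinearMap.ker_eq_bot']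
    intro v hv
    have hv' : A v = 0 := hv
    have h := (A - ContinuousLinearMap.id ℂ (Fin n → ℂ)).le_of_opNorm_le hA v
    rw [_root_.sub_apply, hv', ContinuousLinearMap.id_apply, zero_sub, norm_neg] at h
    exact norm_le_zero_iff.1 (by linarith [norm_nonneg v])
  exact ⟨hinj, LinearMap.injective_iff_surjective.1 hinj⟩

theorem norm_le_of_norm_sub_id_le {A : (Fin n → ℂ) →L[ℂ] (Fin n → ℂ)}
    (hA : ‖A - ContinuousLinearMap.id ℂ (Fin n → ℂ)‖ ≤ 1 / 3) (v : Fin n → ℂ) :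
    ‖v‖ ≤ 3 / 2 * ‖A v‖ := by
  have h := (A - ContinuousLinearMap.id ℂ (Fin n → ℂ)).le_of_opNorm_le hA v
  rw [_root_.sub_apply, ContinuousLinearMap.id_apply] at h
  have h2 := norm_sub_norm_le v (A v)
  rw [norm_sub_rev] at h2
  linarith

theorem isUnit_of_norm_sub_id_le {A : (Fin n → ℂ) →L[ℂ] (Fin n → ℂ)}
    (hA : ‖A - ContinuousLinearMap.id ℂ (Fin n → ℂ)‖ ≤ 1 / 3) :
    ∃ e : (Fin n → ℂ) ≃L[ℂ] (Fin n → ℂ), (e : (Fin n → ℂ) →L[ℂ] (Fin n → ℂ)) = A :=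
  ⟨(LinearEquiv.ofBijective A.toLinearMap (bijective_of_norm_sub_id_le hA)).toContinuousLinearEquiv,
    by ext; rfl⟩

theorem eq_of_norm_fderiv_sub_id_le {r : ℝ} {Φ : (Fin n → ℂ) → (Fin n → ℂ)}
    (hΦ : DifferentiableOn ℂ Φ (strip n r))
    (hΦ' : ∀ z ∈ strip n r, ‖fderiv ℂ Φ z - ContinuousLinearMap.id ℂ (Fin n → ℂ)‖ ≤ 1 / 3)
    {z w : Fin n → ℂ} (hz : z ∈ strip n r) (hw : w ∈ strip n r) (h : Φ z = Φ w) : z = w := by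
  have h1 := (convex_strip r).norm_image_sub_le_of_norm_hasFDerivWithin_le (𝕜 := ℂ)
    (f := fun z => Φ z - z)
    (fun u hu => (((hΦ u hu).differentiableAt
      ((isOpen_strip r).mem_nhds hu)).hasFDerivAt.sub (hasFDerivAt_id u)).hasFDerivWithinAt)
    hΦ' hz hw
  have h2 : Φ w - w - (Φ z - z) = z - w := by rw [h]; abel
  rw [h2, norm_sub_rev] at h1
  rw [eq_comm, ← sub_eq_zero]
  exact norm_le_zero_iff.1 (by linarith [norm_nonneg (w - z)])

theorem isOpen_image_of_norm_fderiv_sub_id_le {r : ℝ} {Φ : (Fin n → ℂ) → (Fin n → ℂ)}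
    (hΦ : DifferentiableOn ℂ Φ (strip n r))
    (hΦ' : ∀ z ∈ strip n r, ‖fderiv ℂ Φ z - ContinuousLinearMap.id ℂ (Fin n → ℂ)‖ ≤ 1 / 3)
    {U : Set (Fin n → ℂ)} (hU : U ⊆ strip n r) (hUo : IsOpen U) : IsOpen (Φ '' U) := by
  rw [isOpen_iff_mem_nhds]
  rintro _ ⟨z, hz, rfl⟩
  have hstrict : HasStrictFDerivAt Φ (fderiv ℂ Φ z) z := by
    refine hasStrictFDerivAt_of_hasFDerivAt_of_continuousAt ?_
      ((differentiableOn_fderiv (isOpen_strip r) hΦ).continuousOn.continuousAt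
        ((isOpen_strip r).mem_nhds (hU hz)))
    filter_upwards [(isOpen_strip r).mem_nhds (hU hz)] with w hw
    exact ((hΦ w hw).differentiableAt ((isOpen_strip r).mem_nhds hw)).hasFDerivAt
  obtain ⟨e, he⟩ := isUnit_of_norm_sub_id_le (hΦ' z (hU hz))
  rw [← he] at hstrict
  rw [← hstrict.map_nhds_eq_of_equiv]
  exact image_mem_map (hUo.mem_nhds hz)

/-- A linear map that is real on real vectors reflects reality. -/
theorem im_eq_zero_of_apply {A : (Fin n → ℂ) →L[ℂ] (Fin n → ℂ)} (hA : Function.Injective A)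
    (hre : ∀ i j, (A (Pi.single i 1) j).im = 0) {v : Fin n → ℂ} (hv : ∀ j, (A v j).im = 0) (i) :
    (v i).im = 0 := by
  have happ : ∀ (u : Fin n → ℂ) (j), A u j = ∑ i, u i * A (Pi.single i 1) j := fun u j => by
    conv_lhs => rw [clm_eq_sum_smulRight A]
    simp
  have h0 : A (realVec fun i => (v i).im) = 0 := by
    funext j
    apply Complex.ext
    · rw [happ, Complex.re_sum, Pi.zero_apply, Complex.zero_re, ← hv j, happ, Complex.im_sum]
      exact Finset.sum_congr rfl fun i _ => by simp [realVec, Complex.mul_re, Complex.mul_im, hre]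
    · rw [happ, Complex.im_sum]
      exact Finset.sum_eq_zero fun i _ => by simp [realVec, Complex.mul_im, hre]
  have h1 := hA (h0.trans (map_zero A).symm)
  have := congrArg Complex.re (congrFun h1 i)
  simpa [realVec] using this

theorem im_fderiv_single {r : ℝ} (hr : 0 < r) {Φ : (Fin n → ℂ) → (Fin n → ℂ)}
    (hΦ : DifferentiableOn ℂ Φ (strip n r)) (hre : RealOnReals Φ) (x : Fin n → ℝ) (i j : Fin n) :
    (fderiv ℂ Φ (realVec x) (Pi.single i 1) j).im = 0 := by
  have hx := realVec_mem_strip hr x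
  have h1 := ((hΦ _ hx).differentiableAt
    ((isOpen_strip r).mem_nhds hx)).hasFDerivAt.restrictScalars ℝ
  have hcurve : HasDerivAt (fun t : ℝ => realVec (x + t • (Pi.single i 1 : Fin n → ℝ)))
      (Pi.single i 1 : Fin n → ℂ) 0 := by
    have h2 : (fun t : ℝ => realVec (x + t • (Pi.single i 1 : Fin n → ℝ))) =
        fun t : ℝ => realVec x + t • (Pi.single i 1 : Fin n → ℂ) := by
      funext t j
      by_cases hj : j = i
      · subst hj; simp [realVec]
      · simp [realVec, hj]
    rw [h2]
    simpa using ((hasDerivAt_id (0 : ℝ)).smul_const (Pi.single i 1 : Fin n → ℂ)).const_add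
      (realVec x)
  have h0 : x + (0 : ℝ) • (Pi.single i 1 : Fin n → ℝ) = x := by simp
  rw [← h0] at h1
  have h3 := h1.comp_hasDerivAt (0 : ℝ) hcurve
  rw [h0] at h3
  have h4 := hasDerivAt_pi.1 h3 j
  have h5 := Complex.imCLM.hasFDerivAt.comp_hasDerivAt (0 : ℝ) h4
  have h6 : (Complex.imCLM ∘ fun t : ℝ =>
      (Φ ∘ fun t : ℝ => realVec (x + t • (Pi.single i 1 : Fin n → ℝ))) t j) = fun _ => 0 :=
    funext fun t => hre _ j
  rw [h6] at h5
  exact h5.unique (hasDerivAt_const _ _)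

end TimeOneMap

/-! ### The averaging step -/

section AveragingStep

/-- The averaging step for a given rational approximation `ω` of the frequency, with error terms in
terms of `η = (Q σ)⁻¹`. -/
theorem exists_averaging_conjugacy {n : ℕ} {s σ ε d B Q : ℝ} {q : ℕ} {l : Fin n → ℤ}
    {α ω : Fin n → ℝ} {P S : (Fin n → ℂ) → (Fin n → ℂ)} (hσ : 0 < σ) (hσs : σ < s) (hε0 : 0 ≤ ε)
    (hd : 0 ≤ d) (hP : IsAnalyticField s P) (hPre : RealOnReals P) (hε : NormLE s P ε)
    (hS : IsAnalyticField s S) (hSd : NormLE s S (d * ε)) (hQ : 0 < Q) (hq : 1 ≤ q)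
    (hv : (q : ℝ) • ω = fun j => (l j : ℝ)) (hαω : ‖α - ω‖ ≤ ((q : ℝ) * Q)⁻¹)
    (hM : q * ε ≤ Q⁻¹) (hη : 8 * (Q⁻¹ * σ⁻¹) ≤ 1)
    (hG : ∀ z ∈ strip n (s - σ),
      ‖weightedAverage (fun _ => 1) ((q : ℝ) • ω) P z - spaceAverage P‖ ≤
        B * (Q⁻¹ * σ⁻¹ * ε)) :
    ∃ Φ P' : (Fin n → ℂ) → (Fin n → ℂ),
      IsRealAnalyticEmbedding (s - σ) s Φ ∧
      IsTimeOneMap (s - σ) s (averagingField q ω P) Φ ∧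
      IsAnalyticField (s - σ) P' ∧
      (RealOnReals S → RealOnReals P') ∧
      (∀ z ∈ strip n (s - σ),
        VectorField.pullback ℂ Φ (fun w => realVec α + P w + S w) z =
          realVec α + S z + spaceAverage P + P' z) ∧
      NormLE (s - σ) (fun z => Φ z - z) (q * ε) ∧
      NormLE (s - σ) P' (3 / 2 * (20 + 5 * d + B) * (Q⁻¹ * σ⁻¹ * ε)) := by
  have hs : 0 < s := hσ.trans hσs
  have hr : 0 < s - σ := sub_pos.2 hσs
  have hq0 : (0 : ℝ) < q := by exact_mod_cast hq
  set v := (q : ℝ) • ω with hvdef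
  set η := Q⁻¹ * σ⁻¹ with hηdef
  have hη0 : 0 < η := by positivity
  have hησ : η * σ = Q⁻¹ := by rw [hηdef]; field_simp
  set M := q * ε with hMdef
  have hM0 : 0 ≤ M := by positivity
  have hMη : M ≤ η * σ := by rw [hησ]; exact hM
  have hMσ : 8 * M ≤ σ := by nlinarith
  set V := averagingField q ω P with hVdef
  set U := weightedAverage (fun t => q * (t - 1 / 2)) v P with hUdef
  set G := weightedAverage (fun _ => 1) v P with hGdef
  have hUd : DifferentiableOn ℂ U (strip n s) :=
    differentiableOn_weightedAverage (by fun_prop) hP.holomorphic hε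
  have hGd : DifferentiableOn ℂ G (strip n s) :=
    differentiableOn_weightedAverage continuous_const hP.holomorphic hε
  have hVU : EqOn V U (strip n s) := fun z hz => averagingField_eq hP hv hz
  have hVd : DifferentiableOn ℂ V (strip n s) := hUd.congr hVU
  have hVM : NormLE s V M := fun z hz => norm_averagingField_le hε hz
  have hVre : RealOnReals V := fun x j => by
    rw [hVU (realVec_mem_strip hs x)]
    exact weightedAverage_real (by fun_prop) hP.holomorphic.continuousOn hs hPre x j
  have hVω : ∀ z ∈ strip n s, fderiv ℂ V z (realVec ω) = P z - G z := by
    intro z hz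
    have h1 : fderiv ℂ V z = fderiv ℂ U z :=
      (hVU.eventuallyEq_of_mem ((isOpen_strip s).mem_nhds hz)).fderiv_eq
    have h2 := fderiv_weightedAverage_apply hP hε q hv hz
    rw [hvdef, realVec_smul, map_smul, ← hvdef, ← hUdef, ← h1] at h2
    have h3 : ((q : ℝ) : ℂ) ≠ 0 := by exact_mod_cast hq0.ne'
    have h4 : ((q : ℝ) : ℂ) • fderiv ℂ V z (realVec ω) = ((q : ℝ) : ℂ) • (P z - G z) := h2
    exact smul_right_injective _ h3 h4
  obtain ⟨Φ, hΦ⟩ := exists_timeOne_map hσ hVd hM0 hVM hMσ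
  -- `2 * M / σ` bounds `DV` on the strip of width `s - σ / 2`, by Cauchy's estimate.
  have hKη : 2 * M / σ ≤ 2 * η := by rw [div_le_iff₀ hσ]; linarith
  have hK0 : 0 ≤ 2 * M / σ := by positivity
  have hderiv : ∀ z ∈ strip n (s - σ), DifferentiableAt ℂ Φ z := fun z hz => by
    obtain ⟨⟨c, W, -, -, -, -, -, -, hW⟩, -⟩ := hΦ z hz
    exact hW.differentiableAt
  have hΦd : DifferentiableOn ℂ Φ (strip n (s - σ)) := fun z hz =>
    (hderiv z hz).differentiableWithinAt
  have hAK : ∀ z ∈ strip n (s - σ),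
      ‖fderiv ℂ Φ z - ContinuousLinearMap.id ℂ (Fin n → ℂ)‖ ≤ 4 / 3 * (2 * M / σ) :=
    fun z hz => by
      obtain ⟨⟨c, W, -, -, -, -, -, hW1, hW⟩, -⟩ := hΦ z hz
      rw [hW.fderiv]; exact hW1
  have hA3 : ∀ z ∈ strip n (s - σ),
      ‖fderiv ℂ Φ z - ContinuousLinearMap.id ℂ (Fin n → ℂ)‖ ≤ 1 / 3 :=
    fun z hz => (hAK z hz).trans (by linarith)
  have hΦM : ∀ z ∈ strip n (s - σ), ‖Φ z - z‖ ≤ M ∧ Φ z ∈ strip n (s - 3 / 4 * σ) :=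
    fun z hz => by
      obtain ⟨⟨c, W, -, hc1, hc, -⟩, -⟩ := hΦ z hz
      have := hc 1 (right_mem_Icc.2 zero_le_one)
      rw [hc1] at this
      exact ⟨this.2.1, this.1⟩
  have hΦs : ∀ z ∈ strip n (s - σ), Φ z ∈ strip n s := fun z hz =>
    strip_mono (by linarith) (hΦM z hz).2
  have hint : ∀ z ∈ strip n (s - σ), ∀ k : Fin n → ℤ, z + intVec k ∈ strip n (s - σ) :=
    fun z hz k => by rw [← realVec_intCast]; exact (add_realVec_mem_strip _).2 hz
  have hequiv : ∀ z ∈ strip n (s - σ), ∀ k : Fin n → ℤ, Φ (z + intVec k) = Φ z + intVec k := by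
    intro z hz k
    obtain ⟨⟨c, W, hc0, hc1, hc, -⟩, -⟩ := hΦ z hz
    rw [← hc1, eq_comm]
    refine (hΦ _ (hint z hz k)).2 (fun t => c t + intVec k) (by rw [hc0]) fun t ht => ⟨?_, ?_⟩
    · rw [← realVec_intCast]; exact (add_realVec_mem_strip _).2 (hc t ht).1
    · have hcs : c t ∈ strip n s := strip_mono (by linarith) (hc t ht).1
      have hcs' : c t + intVec k ∈ strip n s := by
        rw [← realVec_intCast]; exact (add_realVec_mem_strip _).2 hcs
      rw [hVU hcs', hUdef, weightedAverage_periodic hP hcs, ← hUdef, ← hVU hcs]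
      exact (hc t ht).2.2.add_const _
  have hΦre : RealOnReals Φ := by
    intro x j
    have hx := realVec_mem_strip hr x
    obtain ⟨⟨c, W, hc0, hc1, hc, -⟩, -⟩ := hΦ _ hx
    rw [← hc1]
    refine im_integralCurve_eq_zero (D := strip n (s - 3 / 4 * σ)) (V := V) (K := M / (3 / 4 * σ))
      (realVec_mem_strip (by linarith)) hVre (fun x hx y hy => ?_) (fun j => ?_)
      (fun t ht => ⟨(hc t ht).1, (hc t ht).2.2⟩) 1 (right_mem_Icc.2 zero_le_one) j
    · exact norm_sub_le_of_strip (by positivity) hVd hVM hy hx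
    · rw [hc0]; simp [realVec]
  -- the remainder is defined by the conjugacy equation
  set P' : (Fin n → ℂ) → (Fin n → ℂ) := fun z =>
    (fderiv ℂ Φ z).inverse (realVec α + P (Φ z) + S (Φ z)) - realVec α - S z - spaceAverage P
    with hP'
  have hinv : ∀ z ∈ strip n (s - σ), ∀ y, fderiv ℂ Φ z ((fderiv ℂ Φ z).inverse y) = y := by
    intro z hz y
    obtain ⟨e, he⟩ := isUnit_of_norm_sub_id_le (hA3 z hz)
    rw [← he, ContinuousLinearMap.inverse_equiv]
    simp
  refine ⟨Φ, P', ⟨hΦd, hΦre, hequiv, hΦs, ?_, fun z hz => bijective_of_norm_sub_id_le (hA3 z hz),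
    fun O hO hOo => isOpen_image_of_norm_fderiv_sub_id_le hΦd hA3 hO hOo⟩, ?_, ⟨?_, ?_⟩, ?_, ?_,
    fun z hz => (hΦM z hz).1, ?_⟩
  · intro z hz w hw k h
    rw [← hequiv w hw] at h
    exact eq_of_norm_fderiv_sub_id_le hΦd hA3 hz (hint w hw k) h
  · intro z hz
    obtain ⟨⟨c, W, hc0, hc1, hc, -⟩, -⟩ := hΦ z hz
    exact ⟨c, hc0, hc1, fun t ht => ⟨strip_mono (by linarith) (hc t ht).1, (hc t ht).2.2⟩⟩
  · intro z hz
    have hcomp : ∀ F : (Fin n → ℂ) → (Fin n → ℂ), DifferentiableOn ℂ F (strip n s) →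
        DifferentiableAt ℂ (fun z => F (Φ z)) z := fun F hF =>
      ((hF _ (hΦs z hz)).differentiableAt ((isOpen_strip s).mem_nhds (hΦs z hz))).comp z
        (hderiv z hz)
    have hSz : DifferentiableAt ℂ S z := by
      have hzs : z ∈ strip n s := strip_mono (by linarith) hz
      exact (hS.holomorphic _ hzs).differentiableAt ((isOpen_strip s).mem_nhds hzs)
    have hDinv : DifferentiableAt ℂ (fun z => (fderiv ℂ Φ z).inverse) z := by
      obtain ⟨e, he⟩ := isUnit_of_norm_sub_id_le (hA3 z hz)
      have h1 : DifferentiableAt ℂ ContinuousLinearMap.inverse (fderiv ℂ Φ z) := by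
        rw [← he]
        exact (contDiffAt_map_inverse (n := 1) e).differentiableAt one_ne_zero
      exact h1.comp z ((differentiableOn_fderiv (isOpen_strip _) hΦd z hz).differentiableAt
        ((isOpen_strip _).mem_nhds hz))
    have hY : DifferentiableAt ℂ (fun z => realVec α + P (Φ z) + S (Φ z)) z :=
      ((hcomp P hP.holomorphic).const_add _).add (hcomp S hS.holomorphic)
    exact (((hDinv.clm_apply hY).sub_const _).sub hSz |>.sub_const _).differentiableWithinAt
  · intro z hz k
    have hD : fderiv ℂ Φ (z + intVec k) = fderiv ℂ Φ z := by
      rw [← fderiv_comp_add_right, ← fderiv_add_const (f := Φ) (intVec k)]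
      refine Filter.EventuallyEq.fderiv_eq ?_
      filter_upwards [(isOpen_strip (s - σ)).mem_nhds hz] with w hw using hequiv w hw k
    simp only [hP']
    rw [hD, hequiv z hz, hP.periodic _ (hΦs z hz), hS.periodic _ (hΦs z hz),
      hS.periodic _ (strip_mono (by linarith) hz)]
  · intro hSre x j
    have hx := realVec_mem_strip hr x
    set y : Fin n → ℝ := fun j => (Φ (realVec x) j).re with hy
    have hyΦ : Φ (realVec x) = realVec y := funext fun j =>
      Complex.ext rfl (by rw [hΦre x j]; simp [realVec])
    have h1 : ((fderiv ℂ Φ (realVec x)).inverse (realVec α + P (Φ (realVec x)) +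
        S (Φ (realVec x))) j).im = 0 := by
      refine im_eq_zero_of_apply (bijective_of_norm_sub_id_le (hA3 _ hx)).1
        (im_fderiv_single hr hΦd hΦre x) (fun j => ?_) j
      rw [hinv _ hx, hyΦ]
      simp [hPre y j, hSre y j, realVec]
    simp only [hP', Pi.sub_apply, Complex.sub_im, h1, hSre x j,
      im_spaceAverage hs hP.holomorphic.continuousOn hPre j]
    simp [realVec]
  · intro z _
    simp only [VectorField.pullback, hP']
    abel
  · intro z hz
    have hzs : z ∈ strip n s := strip_mono (by linarith) hz
    have hz2 : z ∈ strip n (s - σ / 2) := strip_mono (by linarith) hz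
    obtain ⟨⟨c, W, hc0, hc1, hc, hW0, hW, hW1, hWΦ⟩, -⟩ := hΦ z hz
    obtain ⟨hΦMz, hΦz⟩ := hΦM z hz
    have hΦz2 : Φ z ∈ strip n (s - σ / 2) := strip_mono (by linarith) hΦz
    set A := W 1 with hA
    have hηε : 0 ≤ η * ε := by positivity
    have hAu : ∀ u : Fin n → ℂ, ‖(A - ContinuousLinearMap.id ℂ (Fin n → ℂ)) u‖ ≤
        4 / 3 * (2 * M / σ) * ‖u‖ := fun u => ContinuousLinearMap.le_of_opNorm_le _ hW1 u
    have e1 : ‖P (Φ z) - P z‖ ≤ 2 * (η * ε) := by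
      refine (norm_sub_le_of_strip (by positivity) hP.holomorphic hε hz2 hΦz2).trans ?_
      calc ε / (σ / 2) * ‖Φ z - z‖ ≤ ε / (σ / 2) * (η * σ) := by
            gcongr; exact hΦMz.trans hMη
        _ = 2 * (η * ε) := by field_simp
    have e2 : ‖S (Φ z) - S z‖ ≤ 2 * d * (η * ε) := by
      refine (norm_sub_le_of_strip (by positivity) hS.holomorphic hSd hz2 hΦz2).trans ?_
      calc d * ε / (σ / 2) * ‖Φ z - z‖ ≤ d * ε / (σ / 2) * (η * σ) := by
            gcongr; exact hΦMz.trans hMη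
        _ = 2 * d * (η * ε) := by field_simp
    have e3 : ‖G z - spaceAverage P‖ ≤ B * (η * ε) := hG z hz
    have hg0 : ∀ w ∈ strip n s, ‖P w - G w‖ ≤ 2 * ε := fun w hw => by
      have h1 := norm_sub_le (P w) (G w)
      linarith [hε w hw, norm_weightedAverage_one_le (v := v) hε hw]
    have e4 : ‖A (realVec ω) - realVec ω - (P z - G z)‖ ≤ 12 * (η * ε) := by
      have h := norm_linear_flow_apply_sub_le (D := strip n (s - σ / 2)) (V' := fderiv ℂ V)
        (g := fun w => P w - G w) (ω := realVec ω) (z := z) (K := 2 * M / σ) (G₀ := 2 * ε)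
        (G₁ := 2 * ε / (σ / 2)) (δ := M) (by linarith)
        (fun w hw => (norm_fderiv_le_of_strip (by positivity) hVd hVM hw).trans
          (le_of_eq (by field_simp)))
        (fun w hw => hVω w (strip_mono (by linarith) hw))
        (fun w hw => hg0 w (strip_mono (by linarith) hw))
        (fun w hw => norm_sub_le_of_strip (by positivity) (hP.holomorphic.sub hGd) hg0 hz2 hw)
        (by positivity) (c := c)
        (fun t ht => ⟨strip_mono (by linarith) (hc t ht).1, (hc t ht).2.1⟩) hW0 hW
      refine h.trans ?_
      calc 2 * ε / (σ / 2) * M + 2 * (2 * M / σ) * (2 * ε)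
          ≤ 2 * ε / (σ / 2) * (η * σ) + 2 * (2 * η) * (2 * ε) := by gcongr
        _ = 12 * (η * ε) := by field_simp; ring
    have e5 : ‖(A - ContinuousLinearMap.id ℂ (Fin n → ℂ)) (realVec α - realVec ω)‖ ≤
        8 / 3 * (η * ε) := by
      refine (hAu _).trans ?_
      have hαω' : ‖realVec α - realVec ω‖ ≤ ((q : ℝ) * Q)⁻¹ := by
        have : realVec α - realVec ω = realVec (α - ω) := by funext j; simp [realVec]
        rw [this, norm_realVec]
        exact hαω
      calc 4 / 3 * (2 * M / σ) * ‖realVec α - realVec ω‖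
          ≤ 4 / 3 * (2 * M / σ) * ((q : ℝ) * Q)⁻¹ := by gcongr
        _ = 8 / 3 * (η * ε) := by rw [hMdef, hηdef]; field_simp; ring
    have e6 : ‖(A - ContinuousLinearMap.id ℂ (Fin n → ℂ)) (S z + spaceAverage P)‖ ≤
        8 / 3 * (1 + d) * (η * ε) := by
      refine (hAu _).trans ?_
      have h1 : ‖S z + spaceAverage P‖ ≤ d * ε + ε :=
        (norm_add_le _ _).trans (add_le_add (hSd z hzs) (norm_spaceAverage_le hs hε))
      calc 4 / 3 * (2 * M / σ) * ‖S z + spaceAverage P‖ ≤ 4 / 3 * (2 * η) * (d * ε + ε) := by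
            gcongr
        _ = 8 / 3 * (1 + d) * (η * ε) := by ring
    have hA3' := hA3 z hz
    have hP'z := norm_le_of_norm_sub_id_le hA3' (P' z)
    -- the conjugacy equation, with `P = (P - G) + (G - [P]) + [P]` and `α = ω + (α - ω)`
    have hAP' : fderiv ℂ Φ z (P' z) = (P (Φ z) - P z) + (S (Φ z) - S z) + (G z - spaceAverage P)
        - (A (realVec ω) - realVec ω - (P z - G z))
        - (A - ContinuousLinearMap.id ℂ (Fin n → ℂ)) (realVec α - realVec ω)
        - (A - ContinuousLinearMap.id ℂ (Fin n → ℂ)) (S z + spaceAverage P) := by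
      simp only [hP', map_sub, hinv z hz]
      rw [hWΦ.fderiv]
      simp only [_root_.sub_apply, ContinuousLinearMap.id_apply, map_add]
      abel
    rw [hAP'] at hP'z
    refine hP'z.trans ?_
    have hfinal : ‖(P (Φ z) - P z) + (S (Φ z) - S z) + (G z - spaceAverage P)
        - (A (realVec ω) - realVec ω - (P z - G z))
        - (A - ContinuousLinearMap.id ℂ (Fin n → ℂ)) (realVec α - realVec ω)
        - (A - ContinuousLinearMap.id ℂ (Fin n → ℂ)) (S z + spaceAverage P)‖ ≤
        2 * (η * ε) + 2 * d * (η * ε) + B * (η * ε) + 12 * (η * ε) + 8 / 3 * (η * ε) +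
          8 / 3 * (1 + d) * (η * ε) :=
      norm_sub_le_of_le (norm_sub_le_of_le (norm_sub_le_of_le
        (norm_add_le_of_le (norm_add_le_of_le e1 e2) e3) e4) e5) e6
    have hdηε : 0 ≤ d * (η * ε) := by positivity
    linarith

/-- The smallness condition on `Q σ^{1-n} e^{-Kσ/2}` controls the resonant Fourier modes. -/
theorem exp_mul_pow_le {m : ℕ} (hm : 1 ≤ m) {σ Q K : ℝ} (hσ : 0 < σ) (hσ1 : σ ≤ 1) (hQ : 1 ≤ Q)
    (h : Q * (σ ^ m)⁻¹ * Real.exp (-(K * σ / 2)) ≤ 1) :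
    Real.exp (-(σ * K)) * (4 / σ) ^ (m + 1) ≤ 4 ^ (m + 1) * (Q⁻¹ * σ⁻¹) := by
  have hQ0 : 0 < Q := by linarith
  have h1 : Real.exp (-(K * σ / 2)) ≤ σ ^ m * Q⁻¹ := by
    calc Real.exp (-(K * σ / 2))
        = (Q * (σ ^ m)⁻¹ * Real.exp (-(K * σ / 2))) * (σ ^ m * Q⁻¹) := by field_simp
      _ ≤ 1 * (σ ^ m * Q⁻¹) := by gcongr
      _ = _ := one_mul _
  have h2 : Real.exp (-(σ * K)) = Real.exp (-(K * σ / 2)) ^ 2 := by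
    rw [← Real.exp_nat_mul]; congr 1; push_cast; ring
  have h3 : (σ ^ m) ^ 2 ≤ σ ^ (m + 1) := by
    rw [← pow_mul]
    exact pow_le_pow_of_le_one hσ.le hσ1 (by omega)
  have h4 : 1 ≤ σ⁻¹ := one_le_inv_iff₀.2 ⟨hσ, hσ1⟩
  have h5 : Q⁻¹ ≤ 1 := inv_le_one_of_one_le₀ hQ
  calc Real.exp (-(σ * K)) * (4 / σ) ^ (m + 1)
      ≤ (σ ^ m * Q⁻¹) ^ 2 * (4 / σ) ^ (m + 1) := by rw [h2]; gcongr
    _ = (σ ^ m) ^ 2 * (Q⁻¹ * Q⁻¹) * (4 / σ) ^ (m + 1) := by ring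
    _ ≤ σ ^ (m + 1) * (Q⁻¹ * 1) * (4 / σ) ^ (m + 1) := by gcongr
    _ = 4 ^ (m + 1) * (Q⁻¹ * 1) := by rw [div_pow]; field_simp
    _ ≤ 4 ^ (m + 1) * (Q⁻¹ * σ⁻¹) := by gcongr

end AveragingStep

end KAM

/-- The dimension is `n = m + 1 ≥ 2`. -/
theorem proposition2p4 (m : ℕ) (hm : 1 ≤ m) (s : ℝ) (hs0 : 0 < s) (hs1 : s ≤ 1)
    (τ : ℝ) (hτ : 0 ≤ τ) (γ : ℝ) (hγ : 0 < γ) :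
    -- a constant `γ'` as used below exists
    (∀ x : Fin m → ℝ, KAM.LinearDiophantine τ γ x →
      ∃ γ' : ℝ, 0 < γ' ∧ KAM.SimultaneousDiophantine τ γ' x) ∧
    -- the averaging step; `C` depends only on `n, s, τ, γ, γ'`
    ∀ γ' : ℝ, 0 < γ' → ∃ C : ℝ, 1 ≤ C ∧
      ∀ x : Fin m → ℝ, KAM.LinearDiophantine τ γ x → KAM.SimultaneousDiophantine τ γ' x →
      ∀ ε : ℝ, 0 ≤ ε →
      ∀ P S : (Fin (m + 1) → ℂ) → (Fin (m + 1) → ℂ),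
        KAM.IsAnalyticField s P → KAM.RealOnReals P → KAM.NormLE s P ε →
        KAM.IsAnalyticField s S → KAM.NormLE s S (KAM.dConst (m + 1) τ * ε) →
      ∀ σ Q : ℝ, 0 < σ → σ < s → 1 ≤ Q →
        Q ^ (m + 1) * ε ≤ 1 →
        C * (Q⁻¹ * σ⁻¹) ≤ 1 →
        Q * (σ ^ m)⁻¹ * Real.exp (-(KAM.gammaStar (m + 1) τ γ γ' *
          Q ^ (1 / KAM.aConst (m + 1) τ) * σ / 2)) ≤ 1 →
      ∃ (q : ℕ) (p : Fin m → ℤ) (Φ P' : (Fin (m + 1) → ℂ) → (Fin (m + 1) → ℂ)),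
        1 ≤ q ∧ (q : ℝ) ≤ Q ^ m ∧
        ‖fun j => x j - (p j : ℝ) / (q : ℝ)‖ ≤ ((q : ℝ) * Q)⁻¹ ∧
        KAM.IsRealAnalyticEmbedding (s - σ) s Φ ∧
        KAM.IsTimeOneMap (s - σ) s
          (KAM.averagingField q (KAM.frequency fun j => (p j : ℝ) / (q : ℝ)) P) Φ ∧
        KAM.IsAnalyticField (s - σ) P' ∧
        (KAM.RealOnReals S → KAM.RealOnReals P') ∧
        (∀ z ∈ KAM.strip (m + 1) (s - σ),
          VectorField.pullback ℂ Φ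
              (fun w => KAM.realVec (KAM.frequency x) + P w + S w) z =
            KAM.realVec (KAM.frequency x) + S z + KAM.spaceAverage P + P' z) ∧
        KAM.NormLE (s - σ) (fun z => Φ z - z) (Q ^ m * ε) ∧
        KAM.NormLE (s - σ) P' ((KAM.bConst (m + 1) τ)⁻¹ * ε) := by
  refine ⟨fun x hx => ⟨γ / m, by positivity, hx.simultaneousDiophantine hm hτ hγ⟩,
    fun γ' hγ' => ?_⟩
  set b := KAM.bConst (m + 1) τ with hb
  set d := KAM.dConst (m + 1) τ with hd
  have hb1 : 1 < b := by
    rw [hb, KAM.bConst]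
    refine Real.one_lt_rpow (by norm_num) ?_
    rw [KAM.aConst]
    push_cast
    have : 0 ≤ ((m : ℝ) + 1 - 1) * τ := by rw [add_sub_cancel_right]; positivity
    positivity
  have hb0 : 0 < b := by linarith
  have hd0 : 0 ≤ d := by
    rw [hd, KAM.dConst, ← hb]
    exact inv_nonneg.2 (sub_nonneg.2 (inv_le_one_of_one_le₀ hb1.le))
  set D : ℝ := 3 / 2 * (20 + 5 * d + 4 ^ (m + 1)) with hD
  have hD0 : 0 ≤ D := by positivity
  -- `8` makes the flow of `V` exist on the smaller strip, and `b * D` brings the remainder down to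
  -- `b⁻¹ * ε`.
  refine ⟨8 + b * D, by nlinarith, ?_⟩
  intro x hx hx' ε hε0 P S hP hPre hPε hS hSε σ Q hσ hσs hQ hQε hC hexp
  have hQ0 : 0 < Q := by linarith
  have hσ1 : σ ≤ 1 := by linarith
  have hη0 : 0 < Q⁻¹ * σ⁻¹ := by positivity
  obtain ⟨q, p, hq, hqQ, hp⟩ := KAM.exists_simultaneous_approx x hQ
  have hq0 : (0 : ℝ) < q := by exact_mod_cast hq
  have hxp : ‖fun j => x j - (p j : ℝ) / (q : ℝ)‖ ≤ ((q : ℝ) * Q)⁻¹ := by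
    have : (fun j => x j - (p j : ℝ) / (q : ℝ)) =
        (q : ℝ)⁻¹ • fun j => (q : ℝ) * x j - (p j : ℝ) := by
      funext j
      simp only [Pi.smul_apply, smul_eq_mul]
      field_simp
    rw [this, norm_smul, norm_inv, Real.norm_natCast, mul_inv]
    gcongr
  set ω : Fin (m + 1) → ℝ := KAM.frequency fun j => (p j : ℝ) / (q : ℝ) with hω
  set l : Fin (m + 1) → ℤ := Fin.cons (q : ℤ) p with hl
  have hv : (q : ℝ) • ω = fun j => (l j : ℝ) := by
    funext j
    refine Fin.cases ?_ (fun i => ?_) j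
    · simp [hω, hl, KAM.frequency]
    · simp only [hω, hl, KAM.frequency, Pi.smul_apply, Fin.cons_succ, smul_eq_mul]
      field_simp
  have hαω : ‖KAM.frequency x - ω‖ ≤ ((q : ℝ) * Q)⁻¹ := by
    refine (pi_norm_le_iff_of_nonneg (by positivity)).2 fun j => ?_
    refine Fin.cases ?_ (fun i => ?_) j
    · simp [hω, KAM.frequency]; positivity
    · exact (norm_le_pi_norm (fun j => x j - (p j : ℝ) / (q : ℝ)) i).trans hxp
  have hM : q * ε ≤ Q⁻¹ := by
    calc q * ε ≤ Q ^ m * ε := by gcongr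
      _ = Q ^ (m + 1) * ε * Q⁻¹ := by rw [pow_succ]; field_simp
      _ ≤ 1 * Q⁻¹ := by gcongr
      _ = Q⁻¹ := one_mul _
  have hη8 : 8 * (Q⁻¹ * σ⁻¹) ≤ 1 := by
    refine le_trans ?_ hC
    have : 0 ≤ b * D := by positivity
    gcongr
    linarith
  have hG : ∀ z ∈ KAM.strip (m + 1) (s - σ),
      ‖KAM.weightedAverage (fun _ => 1) ((q : ℝ) • ω) P z - KAM.spaceAverage P‖ ≤
        4 ^ (m + 1) * (Q⁻¹ * σ⁻¹ * ε) := by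
    intro z hz
    refine (KAM.norm_weightedAverage_sub_spaceAverage_le hP hσ hσ1 hPε hv
      (fun k hk hkl => KAM.gammaStar_mul_le_norm hm hτ hγ hγ' hx hx' hQ hq hp hk ?_) hz).trans ?_
    · rw [Fin.sum_univ_succ] at hkl
      simpa [hl, mul_comm] using hkl
    · have h := KAM.exp_mul_pow_le hm hσ hσ1 hQ hexp
      calc _ = ε * (Real.exp (-(σ * (KAM.gammaStar (m + 1) τ γ γ' *
            Q ^ (1 / KAM.aConst (m + 1) τ)))) * (4 / σ) ^ (m + 1)) := by
            ring
        _ ≤ ε * (4 ^ (m + 1) * (Q⁻¹ * σ⁻¹)) := by gcongr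
        _ = _ := by ring
  obtain ⟨Φ, P', hemb, htime, hP', hreal, hpull, hnear, hsmall⟩ :=
    KAM.exists_averaging_conjugacy (B := 4 ^ (m + 1)) (α := KAM.frequency x) hσ hσs hε0 hd0 hP hPre
      hPε hS hSε hQ0 hq hv hαω hM hη8 hG
  refine ⟨q, p, Φ, P', hq, hqQ, hxp, hemb, htime, hP', hreal, hpull, fun z hz => ?_, fun z hz => ?_⟩
  · exact (hnear z hz).trans (by gcongr)
  · refine (hsmall z hz).trans ?_
    have hDη : D * (Q⁻¹ * σ⁻¹) ≤ b⁻¹ := by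
      rw [le_inv_comm₀ (by positivity) hb0, ← one_div, le_div_iff₀ (by positivity)]
      linarith [mul_assoc b D (Q⁻¹ * σ⁻¹)]
    calc _ = D * (Q⁻¹ * σ⁻¹) * ε := by rw [hD]; ring
      _ ≤ b⁻¹ * ε := by gcongr
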